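/- **Notation and principles.** Let $S^2_0=\{\alpha<\omega_2\mid \mathrm{cf}\,\alpha=\omega\}$ and $S^2_1=\{\alpha<\omega_2\mid \mathrm{cf}\,\alpha=\omega_1\}$. An $S^2_0$-system is a sequence $\langle C_\alpha\mid\alpha\in S^2_0\rangle$ such that each $C_\alpha$ is a countable unbounded subset of $\alpha$. For $C\subseteq S^2_0$, the sequence $\langle C_\alpha\mid\alpha\in C\rangle$ is *end-extending* if for all $\alpha<\alpha'$ in $C$ we have $C_\alpha\subseteq C_{\alpha'}$ and every element of $C_{\alpha'}\setminus C_\alpha$ is greater than every element of $C_\alpha$. * $\mathrm{SCL^-_e}$ states that there is an $S^2_0$-system $\langle C_\alpha\mid\alpha\in S^2_0\rangle$ such that for every $\beta\in S^2_1$ there is a club subset $C$ of $\beta\cap S^2_0$ of order type $\omega_1$ such that $\langle C_\alpha\mid\alpha\in C\rangle$ is end-extending. * $\mathrm{SCL_e}$ states that there are an $S^2_0$-system $\langle C_\alpha\mid\alpha\in S^2_0\rangle$ and a function $f:S^2_0\to\omega_1$ such that for every $\beta\in S^2_1$ there is a club subset $C$ of $\beta\cap S^2_0$ of order type $\omega_1$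 such that $f(\alpha)=\mathrm{o.t.}(C\cap\alpha)$ for every $\alpha\in C$ and $\langle C_\alpha\mid\alpha\in C\rangle$ is end-extending. Here a club subset $C$ of $\beta\cap S^2_0$ is a subset of $\beta\cap S^2_0$ that is unbounded in $\beta$ and contains every $\delta\in\beta\cap S^2_0$ in which $C\cap\delta$ is unbounded. **The game.** Let $\mathbb P$ be a separative poset (for $p\not\le q$ there is $r\le p$ incompatible with $q$) with Boolean completion $\mathcal B(\mathbb P)$; "$p$ is stronger than $q$" means $p\le q$. The game $G^{**}(\mathbb P)$ is played by Players $\mathrm I$ and $\mathrm{II}$ in at most $\omega_1+1$ rounds. In round $\alpha<\omega_1$, Player $\mathrm I$ chooses a countable set $A_\alpha\subseteq\mathbb P$, and then Player $\mathrm{II}$ chooses $b_\alpha\in\mathbb P$, subject to the following rules. * If $\alpha$ is not a limit ordinal, then $A_\alpha\supseteq A_\gamma$ for all $\gamma<\alpha$; the Boolean infimum $a_\alpha$ of $A_\alpha$ in $\mathcal B(\mathbb P)$ is positive; if $\alpha=\beta+1$, then $a_\alpha\le b_\beta$ and also $p\le b_\beta$ for every $p\in A_\alpha\setminus A_\beta$;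 and $b_\alpha\le a_\alpha$. * If $\alpha$ is a limit ordinal, then $A_\alpha=\bigcup_{\gamma<\alpha}A_\gamma$, and $b_\alpha$ must be stronger than every condition in $A_\alpha$. In round $\omega_1$ only Player $\mathrm{II}$ moves, and she must choose $b_{\omega_1}\in\mathbb P$ stronger than all preceding moves. Player $\mathrm{II}$ wins if she is able to make legal moves in all rounds. A *$*$-operation* is a function $\sigma$ giving a condition $\sigma(A,\alpha)\in\mathbb P$ for a countable $A\subseteq\mathbb P$ and an ordinal $\alpha$; a *$*$-tactic* is a function $\tau$ giving a condition $\tau(A)\in\mathbb P$ for a countable $A\subseteq\mathbb P$. A poset $\mathbb P$ is *$**$-operationally closed* (resp. *$**$-tactically closed*) if it is separative and there is a $*$-operation $\sigma$ (resp. a $*$-tactic $\tau$) such that $\mathrm{II}$ wins every play of $G^{**}(\mathbb P)$ in which she plays $b_\alpha=\sigma(A_\alpha,\alpha)$ (resp. $b_\alpha=\tau(A_\alpha)$) in each round $\alpha<\omega_1$ (in particular, she has a legal move in round $\omega_1$). **Martin-type axioms.** For a class $\Gamma$ of posets, $\mathrm{MA}_{\omega_2}(\Gamma)$ states that for every $\mathbb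 P\in\Gamma$, every $p\in\mathbb P$ and every family $\{D_\alpha\mid\alpha<\omega_2\}$ of dense subsets of $\mathbb P$ there is a filter $\mathcal F\subseteq\mathbb P$ with $p\in\mathcal F$ and $D_\alpha\cap\mathcal F\neq\emptyset$ for all $\alpha<\omega_2$. **Theorem.** 1. $\mathrm{SCL^-_e}$ is equivalent to $\mathrm{MA}_{\omega_2}(\text{$**$-tactically closed posets})$. 2. $\mathrm{SCL_e}$ is equivalent to $\mathrm{MA}_{\omega_2}(\text{$**$-operationally closed posets})$. -/

import Mathlib

universe u

namespace DoubleStar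

open Ordinal Cardinal

/-! ### End-extension variations of the setwise climbability principles -/

/-- `S²₀`: the ordinals below `ω₂` of cofinality `ω`. -/
def S20 : Set Ordinal.{0} := {α | α < ω_ 2 ∧ α.cof = ℵ₀}

/-- `S²₁`: the ordinals below `ω₂` of cofinality `ω₁`. -/
def S21 : Set Ordinal.{0} := {α | α < ω_ 2 ∧ α.cof = ℵ_ 1}

/-- The order type of a set of ordinals (it lives one universe up, as `Set Ordinal` does). -/
noncomputable def otp (S : Set Ordinal.{0}) : Ordinal.{1} :=
  Ordinal.type (α := S) (· < ·)

/-- `X` is unbounded in the ordinal `α`. -/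
def UnboundedIn (X : Set Ordinal.{0}) (α : Ordinal.{0}) : Prop :=
  ∀ ξ < α, ∃ η ∈ X, ξ < η ∧ η < α

/-- `C` is a club subset of `β ∩ S²₀`: it is a subset of `β ∩ S²₀` which is unbounded in `β` and
contains each of its limit points that belong to `β ∩ S²₀`. -/
def IsClubInS20 (C : Set Ordinal.{0}) (β : Ordinal.{0}) : Prop :=
  C ⊆ Set.Iio β ∩ S20 ∧ UnboundedIn C β ∧ ∀ δ ∈ Set.Iio β ∩ S20, UnboundedIn C δ → δ ∈ C

/-- `Y` is an end-extension of `X`. -/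
def EndExtends (Y X : Set Ordinal.{0}) : Prop :=
  X ⊆ Y ∧ ∀ η ∈ Y \ X, ∀ ξ ∈ X, ξ < η

/-- `⟨C_α | α ∈ S²₀⟩` is an `S²₀`-system: each `C_α` is a countable unbounded subset of `α`.
The values of `Cs` outside of `S²₀` are irrelevant. -/
def IsS20System (Cs : Ordinal.{0} → Set Ordinal.{0}) : Prop :=
  ∀ α ∈ S20, (Cs α).Countable ∧ Cs α ⊆ Set.Iio α ∧ UnboundedIn (Cs α) α

/-- `⟨C_α | α ∈ C⟩` is end-extending. -/
def EndExtendingOn (Cs : Ordinal.{0} → Set Ordinal.{0}) (C : Set Ordinal.{0}) : Prop :=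
  ∀ α ∈ C, ∀ α' ∈ C, α < α' → EndExtends (Cs α') (Cs α)

/-- `SCL⁻ₑ`-systems. -/
def IsSCLeMinusSystem (Cs : Ordinal.{0} → Set Ordinal.{0}) : Prop :=
  IsS20System Cs ∧ ∀ β ∈ S21, ∃ C : Set Ordinal.{0},
    IsClubInS20 C β ∧ otp C = ω_ 1 ∧ EndExtendingOn Cs C

/-- The principle `SCL⁻ₑ`. -/
def SCLeMinus : Prop := ∃ Cs : Ordinal.{0} → Set Ordinal.{0}, IsSCLeMinusSystem Cs

/-- `SCLₑ`-pairs; `f` represents a function from `S²₀` to `ω₁`. -/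
def IsSCLePair (f : Ordinal.{0} → Ordinal.{0}) (Cs : Ordinal.{0} → Set Ordinal.{0}) : Prop :=
  (∀ α ∈ S20, f α < ω_ 1) ∧ IsS20System Cs ∧ ∀ β ∈ S21, ∃ C : Set Ordinal.{0},
    IsClubInS20 C β ∧ otp C = ω_ 1 ∧
      (∀ α ∈ C, Ordinal.lift.{1} (f α) = otp (C ∩ Set.Iio α)) ∧ EndExtendingOn Cs C

/-- The principle `SCLₑ`. -/
def SCLe : Prop :=
  ∃ (f : Ordinal.{0} → Ordinal.{0}) (Cs : Ordinal.{0} → Set Ordinal.{0}), IsSCLePair f Cs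

/-! ### Posets and their Boolean completions -/

section Posets

variable (P : Type u) [PartialOrder P]

/-- Separative posets (`q ≤ p` means that `q` is stronger than `p`). -/
def Separative : Prop :=
  ∀ p q : P, ¬ p ≤ q → ∃ r ≤ p, ¬ ∃ s, s ≤ r ∧ s ≤ q

/-- The Boolean completion of `P`: the regular elements (`aᶜᶜ = a`) of the complete Heyting algebra
of downward closed subsets of `P`, i.e. the regular open algebra of `P`. -/
abbrev BooleanCompletion : Type u := Heyting.Regular (LowerSet P)

variable {P}

/-- The canonical map from `P` to its Boolean completion. -/
def toCompletion (p : P) : BooleanCompletion P := Heyting.Regular.toRegular (LowerSet.Iic p)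

/-- The Boolean infimum of a set of conditions, computed in the Boolean completion. -/
def boolInf (A : Set P) : BooleanCompletion P :=
  ⟨⨅ p ∈ A, (toCompletion p).val, by
    refine le_antisymm (le_iInf₂ fun p hp => ?_) le_compl_compl
    have h : (⨅ p ∈ A, (toCompletion p).val) ≤ (toCompletion p).val := iInf₂_le p hp
    exact (compl_le_compl (compl_le_compl h)).trans (toCompletion p).prop.le⟩

theorem isGLB_boolInf (A : Set P) : IsGLB (toCompletion '' A) (boolInf A) := by
  constructor
  · rintro _ ⟨p, hp, rfl⟩
    exact iInf₂_le (f := fun (p : P) (_ : p ∈ A) => (toCompletion p).val) p hp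
  · intro c hc
    exact Heyting.Regular.coe_le_coe.1
      (le_iInf₂ fun p hp => Heyting.Regular.coe_le_coe.2 (hc ⟨p, hp, rfl⟩))

theorem mem_toCompletion {p r : P} : r ∈ (toCompletion p).val ↔ ∀ s ≤ r, ∃ t ≤ s, t ≤ p := by
  have key : ∀ (U : LowerSet P) (x : P), x ∈ Uᶜ ↔ ∀ y ≤ x, y ∉ U := by
    intro U x
    have h : LowerSet.Iic x ≤ Uᶜ ↔ Disjoint (LowerSet.Iic x) U := le_compl_iff_disjoint_right
    rw [LowerSet.Iic_le] at h
    rw [h, disjoint_iff_inf_le]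
    constructor
    · intro h' y hy hU
      exact h' (show y ∈ LowerSet.Iic x ⊓ U from ⟨hy, hU⟩)
    · rintro h' y ⟨hy, hU⟩
      exact absurd hU (h' y hy)
  change r ∈ (LowerSet.Iic p)ᶜᶜ ↔ _
  simp only [key, LowerSet.mem_Iic_iff]
  push Not
  rfl

theorem toCompletion_le_toCompletion (hP : Separative P) {p q : P} : toCompletion p ≤ toCompletion q ↔ p ≤ q := by
  constructor
  · intro h
    by_contra hpq
    obtain ⟨r, hr, hrq⟩ := hP p q hpq
    have hp : r ∈ (toCompletion p).val := mem_toCompletion.2 fun s hs => ⟨s, le_rfl, hs.trans hr⟩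
    have hq : r ∈ (toCompletion q).val := h hp
    obtain ⟨t, ht, htq⟩ := mem_toCompletion.1 hq r le_rfl
    exact hrq ⟨t, ht, htq⟩
  · intro h
    exact Heyting.Regular.toRegular.monotone (LowerSet.Iic_le.2 h)

theorem toCompletion_le_boolInf (hP : Separative P) {A : Set P} {b : P} :
    toCompletion b ≤ boolInf A ↔ b ∈ lowerBounds A := by
  rw [le_isGLB_iff (isGLB_boolInf A)]
  constructor
  · intro h p hp
    exact (toCompletion_le_toCompletion hP).1 (h ⟨p, hp, rfl⟩)
  · rintro h _ ⟨p, hp, rfl⟩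
    exact (toCompletion_le_toCompletion hP).2 (h hp)

/-! ### The game `G**(P)` -/

/-- Assuming that all moves in the rounds before `α` were legal, `A α` is a legal move of Player I
in round `α < ω₁`, where `A γ` and `b γ` are the moves of Players I and II in round `γ`. -/
def LegalI (A : Ordinal.{0} → Set P) (b : Ordinal.{0} → P) (α : Ordinal.{0}) : Prop :=
  (Order.IsSuccLimit α → A α = ⋃ γ < α, A γ) ∧
  (¬ Order.IsSuccLimit α →
    (A α).Countable ∧ (∀ γ < α, A γ ⊆ A α) ∧ boolInf (A α) ≠ ⊥ ∧
    ∀ β, α = Order.succ β →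
      boolInf (A α) ≤ toCompletion (b β) ∧ ∀ p ∈ A α \ A β, p ≤ b β)

/-- `b α` is a legal move of Player II in round `α < ω₁`. -/
def LegalII (A : Ordinal.{0} → Set P) (b : Ordinal.{0} → P) (α : Ordinal.{0}) : Prop :=
  (Order.IsSuccLimit α → b α ∈ lowerBounds (A α)) ∧
  (¬ Order.IsSuccLimit α → toCompletion (b α) ≤ boolInf (A α))

/-- Player II wins any play of `G**(P)` as long as she plays by the `*`-operation `σ`, i.e. as long
as she answers `σ (A α) α` to the move `A α` of Player I in each round `α < ω₁`: her answer is legal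
in each round `α < ω₁` that is reached, and whenever all the rounds `α < ω₁` have been played, she
has a legal move in round `ω₁`. Only values of `σ` at countable sets are relevant. -/
def IsWinning (σ : Set P → Ordinal.{0} → P) : Prop :=
  ∀ (A : Ordinal.{0} → Set P) (b : Ordinal.{0} → P), (∀ α < ω_ 1, b α = σ (A α) α) →
    (∀ α < ω_ 1, (∀ γ ≤ α, LegalI A b γ) → (∀ γ < α, LegalII A b γ) → LegalII A b α) ∧
    ((∀ α < ω_ 1, LegalI A b α ∧ LegalII A b α) →
      ∃ c : P, ∀ α < ω_ 1, c ∈ lowerBounds (A α) ∧ c ≤ b α)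

variable (P)

/-- `**`-operationally closed posets. -/
def OperationallyClosed : Prop :=
  Separative P ∧ ∃ σ : Set P → Ordinal.{0} → P, IsWinning σ

/-- `**`-tactically closed posets. -/
def TacticallyClosed : Prop :=
  Separative P ∧ ∃ τ : Set P → P, IsWinning (fun A _ => τ A)

/-! ### Martin-type axioms -/

/-- `MA_λ(P)`: for every `p` and dense sets `D_α` (`α < λ`) there is a filter containing `p` and
meeting all `D_α`. -/
def MA (lam : Ordinal.{0}) : Prop :=
  ∀ (p : P) (D : Ordinal.{0} → Set P), (∀ α < lam, ∀ q, ∃ r ∈ D α, r ≤ q) →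
    ∃ F : Order.PFilter P, p ∈ F ∧ ∀ α < lam, ∃ r ∈ D α, r ∈ F

end Posets

/-- `MA_λ(Γ)` for a class `Γ` of posets. -/
def MAClass (lam : Ordinal.{0}) (Γ : ∀ (P : Type u) [PartialOrder P], Prop) : Prop :=
  ∀ (P : Type u) [PartialOrder P], Γ P → MA P lam

end DoubleStar

universe v

namespace DoubleStar

open Ordinal Cardinal

/-! ### Ordinals below `ω₂` -/

/-! Separativity lets every clause about Boolean infima be read off from lower bounds in `P` itself,
and a winning operation makes `P` closed under meeting `ℵ₁` many dense sets.

From the principles to the axioms (`IsWinning.ma`). A descending sequence `c` of length `ω₂` is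
built whose successor steps meet the given dense sets; the filter is its upward closure. Only limits
are a problem. At `α ∈ S²₀` the next condition is `σ (c '' C_α) (f α)` whenever this is a lower
bound of the earlier conditions. At `β ∈ S²₁`, end-extension along the club `C` turns the sets `c ''
C_α` (`α ∈ C`) into legal moves of Player I in a play where the answers of Player II are the `c α`;
Player II survives round `ω₁`, which bounds the sequence below `β`
(`IsWinning.exists_lowerBound_of_club`). At `α ∈ S²₀` the set `C_α` may be useless, so a lower bound
has to exist for another reason: each successor step also anticipates every finite play built from a
pool of at most `ℵ₁` auxiliary conditions, so that some play of length `ω` is interleaved with a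
cofinal part of the sequence (`IsWinning.exists_lowerBound_of_mem_S20`). A tactic ignores the round
and needs no `f`; an operation needs `f α` to be the index of `α` in the club.

From the axioms to the principles. The poset `Cond w` of initial segments of a system is used, the
proposition `w` switching the requirement on `f` on or off. Player II extends the moves so far to
the supremum `δ` of their lengths and, if it is not attained, declares `C_δ` to be the set of these
lengths. The Boolean rule forces Player I to exhaust each answer, and new moves lie below earlier
answers; hence the suprema at limit rounds form a club on which the declared sets are end-extending
(`Cond.Played.goodAt`). So Player II wins, conditions of every length below `ω₂` are dense, and a
filter meeting these dense sets is a full system. -/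

theorem card_le_aleph_one_of_lt {γ : Ordinal.{0}} (h : γ < ω_ 2) : γ.card ≤ ℵ_ 1 := by
  have h2 := lt_omega_iff_card_lt.1 h
  rw [← one_add_one_eq_two, ← succ_aleph] at h2
  exact Order.lt_succ_iff.1 h2

theorem countable_Iio_of_lt {γ : Ordinal.{0}} (h : γ < ω_ 1) : (Set.Iio γ).Countable := by
  have h2 := lt_omega_iff_card_lt.1 h
  rw [← Cardinal.le_aleph0_iff_set_countable, Cardinal.mk_Iio_ordinal]
  rw [← succ_aleph0, Order.lt_succ_iff] at h2
  exact lift_le_aleph0.2 h2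

theorem isSuccLimit_omega_one : Order.IsSuccLimit (ω_ 1 : Ordinal.{0}) := isSuccLimit_omega 1

theorem isSuccLimit_omega_two : Order.IsSuccLimit (ω_ 2 : Ordinal.{0}) := isSuccLimit_omega 2

theorem cof_omega_two : (ω_ 2 : Ordinal.{0}).cof = ℵ_ 2 := by
  have h := (isRegular_aleph_add_one 1).cof_ord
  rwa [ord_aleph, one_add_one_eq_two] at h

theorem aleph_one_lt_aleph_two : ℵ_ 1 < (ℵ_ 2 : Cardinal.{u}) :=
  aleph_lt_aleph.2 one_lt_two

theorem iSup_lt_omega_two (f : Ordinal.{0} → Ordinal.{0})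
    (hf : ∀ i < ω_ 1, f i < ω_ 2) {o : Ordinal.{0}} (ho : o ≤ ω_ 1) :
    ⨆ i : Set.Iio o, f i < ω_ 2 := by
  apply Ordinal.lift_iSup_lt_of_lt_cof
  · rw [← lift_cof, cof_omega_two, Cardinal.mk_Iio_ordinal]
    have h : o.card ≤ ℵ_ 1 := (card_le_card ho).trans (by simp)
    rw [Cardinal.lift_uzero, Cardinal.lift_lt]
    exact h.trans_lt aleph_one_lt_aleph_two
  · exact fun i => hf i (i.2.trans_le ho)

/-! ### Cofinalities -/

theorem isSuccLimit_of_mem_S20 {α : Ordinal.{0}} (h : α ∈ S20) : Order.IsSuccLimit α :=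
  one_lt_cof_iff.1 (h.2.symm ▸ one_lt_aleph0)

theorem isSuccLimit_of_mem_S21 {α : Ordinal.{0}} (h : α ∈ S21) : Order.IsSuccLimit α :=
  one_lt_cof_iff.1 (h.2.symm ▸ one_lt_aleph0.trans aleph0_lt_aleph_one)

theorem not_mem_S21_of_mem_S20 {α : Ordinal.{0}} (h : α ∈ S20) : α ∉ S21 := fun h' =>
  aleph0_lt_aleph_one.ne (h.2.symm.trans h'.2)

theorem mem_S20_or_mem_S21 {α : Ordinal.{0}} (h : α < ω_ 2) (hl : Order.IsSuccLimit α) :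
    α ∈ S20 ∨ α ∈ S21 := by
  have h1 : α.cof ≤ ℵ_ 1 := (cof_le_card α).trans (card_le_aleph_one_of_lt h)
  have h0 : ℵ₀ ≤ α.cof := aleph0_le_cof_iff.2 (one_lt_cof_iff.2 hl)
  rcases h1.lt_or_eq with h2 | h2
  · rw [← succ_aleph0, Order.lt_succ_iff] at h2
    exact Or.inl ⟨h, h2.antisymm h0⟩
  · exact Or.inr ⟨h, h2⟩

theorem UnboundedIn.mem_S20 {δ : Ordinal.{0}} {X : Set Ordinal.{0}} (hX : UnboundedIn X δ)
    (hc : X.Countable) (hδ : δ < ω_ 2) (h0 : δ ≠ 0) : δ ∈ S20 := by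
  have hl : Order.IsSuccLimit δ := by
    refine ⟨by simpa using h0, fun ξ hξ => ?_⟩
    obtain ⟨η, -, h1, h2⟩ := hX ξ hξ.lt
    exact hξ.2 h1 h2
  refine ⟨hδ, le_antisymm ?_ (aleph0_le_cof_iff.2 (one_lt_cof_iff.2 hl))⟩
  have hs : IsCofinal {x : Set.Iio δ | x.1 ∈ X} := by
    intro x
    obtain ⟨η, h1, h2, h3⟩ := hX x x.2
    exact ⟨⟨η, h3⟩, h1, h2.le⟩
  have := Order.cof_le hs
  rw [cof_Iio] at this
  have h2 : #{x : Set.Iio δ | x.1 ∈ X} ≤ ℵ₀ :=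
    Cardinal.le_aleph0_iff_set_countable.2 (hc.preimage Subtype.val_injective)
  exact lift_le_aleph0.1 ((lift_cof δ).trans_le ((this.trans h2)))

theorem exists_sequence_of_mem_S20 {α : Ordinal.{0}} (h : α ∈ S20) :
    ∃ a : ℕ → Ordinal.{0}, StrictMono a ∧ (∀ n, a n < α) ∧ ∀ ξ < α, ∃ n, ξ < a n := by
  have hl := isSuccLimit_of_mem_S20 h
  obtain ⟨s, hs, hc⟩ := Order.exists_cof_eq (Set.Iio α)
  rw [cof_Iio, ← lift_cof, h.2, lift_aleph0] at hc
  have hsc : s.Countable := Cardinal.le_aleph0_iff_set_countable.1 hc.le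
  have hne : s.Nonempty := by
    rw [Set.nonempty_iff_ne_empty]
    rintro rfl
    simp [aleph0_ne_zero.symm] at hc
  obtain ⟨e, rfl⟩ := hsc.exists_eq_range hne
  have hlt : ∀ x < α, Order.succ x < α := fun x hx => hl.succ_lt hx
  let a : ℕ → Ordinal.{0} := fun n => Nat.rec (Order.succ (e 0).1)
    (fun n x => Order.succ (max x (e (n + 1)).1)) n
  have ha : ∀ n, a n < α := by
    intro n
    induction n with
    | zero => exact hlt _ (e 0).2
    | succ n ih => exact hlt _ (max_lt ih (e (n + 1)).2)
  have he : ∀ n, (e n).1 < a n := by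
    intro n
    cases n with
    | zero => exact Order.lt_succ _
    | succ n => exact Order.lt_succ_iff.2 (le_max_right _ _)
  refine ⟨a, strictMono_nat_of_lt_succ fun n => Order.lt_succ_iff.2 (le_max_left _ _), ha, ?_⟩
  intro ξ hξ
  obtain ⟨_, ⟨n, rfl⟩, hn⟩ := hs ⟨ξ, hξ⟩
  exact ⟨n, lt_of_le_of_lt hn (he n)⟩

theorem exists_countable_unbounded {α : Ordinal.{0}} (h : α ∈ S20) :
    ∃ X : Set Ordinal.{0}, X.Countable ∧ X ⊆ Set.Iio α ∧ UnboundedIn X α := by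
  obtain ⟨a, -, ha, hc⟩ := exists_sequence_of_mem_S20 h
  refine ⟨Set.range a, Set.countable_range a, Set.range_subset_iff.2 ha, fun ξ hξ => ?_⟩
  obtain ⟨n, hn⟩ := hc ξ hξ
  exact ⟨a n, ⟨n, rfl⟩, hn, ha n⟩

/-! ### Order types -/

theorem otp_image_Iio {g : Ordinal.{0} → Ordinal.{0}} {o : Ordinal.{0}}
    (hg : StrictMonoOn g (Set.Iio o)) : otp (g '' Set.Iio o) = Ordinal.lift.{1} o := by
  rw [← type_lt_Iio]
  exact (Ordinal.type_eq.2 ⟨(hg.orderIso g _).toRelIsoLT⟩).symm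

theorem otp_image_inter_Iio {g : Ordinal.{0} → Ordinal.{0}} {o ξ : Ordinal.{0}}
    (hg : StrictMonoOn g (Set.Iio o)) (hξ : ξ < o) :
    otp (g '' Set.Iio o ∩ Set.Iio (g ξ)) = Ordinal.lift.{1} ξ := by
  have h : g '' Set.Iio o ∩ Set.Iio (g ξ) = g '' Set.Iio ξ := by
    ext x
    constructor
    · rintro ⟨⟨η, hη, rfl⟩, h⟩
      exact ⟨η, (hg.lt_iff_lt hη hξ).1 h, rfl⟩
    · rintro ⟨η, hη, rfl⟩
      exact ⟨⟨η, lt_trans hη hξ, rfl⟩, hg (lt_trans hη hξ) hξ hη⟩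
  rw [h, otp_image_Iio (hg.mono (Set.Iio_subset_Iio hξ.le))]

theorem exists_enumeration {C : Set Ordinal.{0}} (hC : otp C = ω_ 1) :
    ∃ g : Ordinal.{0} → Ordinal.{0}, StrictMonoOn g (Set.Iio (ω_ 1)) ∧ C = g '' Set.Iio (ω_ 1) := by
  have h : otp C = typeLT (Set.Iio (ω_ 1 : Ordinal.{0})) := by
    rw [hC, type_lt_Iio, lift_omega]; simp
  obtain ⟨e⟩ := Ordinal.type_eq.1 h
  classical
  refine ⟨fun ξ => if hξ : ξ < ω_ 1 then (e.symm ⟨ξ, hξ⟩).1 else 0, ?_, ?_⟩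
  · intro a ha b hb hab
    simp only [Set.mem_Iio] at ha hb
    simp only [ha, hb, dif_pos]
    exact e.symm.map_rel_iff.2 hab
  · ext x
    constructor
    · intro hx
      refine ⟨(e ⟨x, hx⟩).1, (e ⟨x, hx⟩).2, ?_⟩
      have := (e ⟨x, hx⟩).2
      simp only [Set.mem_Iio] at this
      simp only [this, dif_pos]
      exact congrArg Subtype.val (e.symm_apply_apply ⟨x, hx⟩)
    · rintro ⟨ξ, hξ, rfl⟩
      simp only [Set.mem_Iio] at hξ
      simp [hξ]

theorem exists_surjection_from_omega_one (ι : Type u) [Nonempty ι] (h : #ι ≤ ℵ_ 1) :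
    ∃ g : Ordinal.{0} → ι, ∀ i, ∃ ξ < ω_ 1, g ξ = i := by
  have h2 : Cardinal.lift.{1} #ι ≤ Cardinal.lift.{u} #(Set.Iio (ω_ 1 : Ordinal.{0})) := by
    rw [Cardinal.mk_Iio_ordinal]
    simpa using h
  obtain ⟨e⟩ := Cardinal.lift_mk_le'.1 h2
  refine ⟨fun ξ => Function.invFun (fun i => (e i).1) ξ, fun i => ⟨(e i).1, (e i).2, ?_⟩⟩
  exact Function.leftInverse_invFun (Subtype.val_injective.comp e.injective) i

/-- Transfinite recursion with choices: if the requirement `R α f y` on the value `y` at `α` depends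
only on the values of `f` below `α`, there is a function which satisfies it wherever possible. -/
theorem exists_transfinite_choice {X : Type*} [Nonempty X]
    (R : Ordinal.{0} → (Ordinal.{0} → X) → X → Prop)
    (hR : ∀ α f g, (∀ γ < α, f γ = g γ) → ∀ y, R α f y → R α g y) :
    ∃ f : Ordinal.{0} → X, ∀ α, (∃ y, R α f y) → R α f (f α) := by
  classical
  let x₀ : X := Classical.arbitrary X
  let E : ∀ α : Ordinal.{0}, (∀ γ < α, X) → Ordinal.{0} → X := fun α ih γ =>
    if h : γ < α then ih γ h else x₀
  let F : ∀ α : Ordinal.{0}, (∀ γ < α, X) → X := fun α ih =>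
    if h : ∃ y, R α (E α ih) y then h.choose else x₀
  let f : Ordinal.{0} → X := WellFounded.fix Ordinal.lt_wf F
  refine ⟨f, fun α ⟨y, hy⟩ => ?_⟩
  have hE : ∀ γ < α, f γ = E α (fun γ _ => f γ) γ := fun γ hγ => by simp [E, hγ]
  have h : ∃ y, R α (E α fun γ _ => f γ) y := ⟨y, hR _ _ _ hE y hy⟩
  have hf : f α = h.choose := by
    rw [show f α = F α fun γ _ => f γ from WellFounded.fix_eq _ _ _]
    exact dif_pos h
  rw [hf]
  exact hR _ _ _ (fun γ hγ => (hE γ hγ).symm) _ h.choose_spec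

/-! ### The game in terms of the order of `P` -/

section Game

variable {P : Type u} [PartialOrder P]

/-- In a separative poset principal down-sets are already regular, so the Boolean infimum is
literally the set of lower bounds. This removes the completion from the rules of the game. -/
theorem mem_boolInf (hP : Separative P) {A : Set P} {r : P} :
    r ∈ (boolInf A).val ↔ r ∈ lowerBounds A := by
  rw [← toCompletion_le_boolInf hP]
  constructor
  · intro h
    have h2 : LowerSet.Iic r ≤ (boolInf A).val := LowerSet.Iic_le.2 h
    have h3 := compl_le_compl (compl_le_compl h2)
    rw [(boolInf A).prop.eq] at h3
    exact h3
  · intro h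
    exact h (mem_toCompletion.2 fun s hs => ⟨s, le_rfl, hs⟩)

theorem boolInf_ne_bot_iff (hP : Separative P) {A : Set P} :
    boolInf A ≠ ⊥ ↔ (lowerBounds A).Nonempty := by
  constructor
  · intro h
    by_contra h2
    refine h (le_bot_iff.1 (Heyting.Regular.coe_le_coe.1 fun r hr => ?_))
    exact absurd ⟨r, (mem_boolInf hP).1 hr⟩ h2
  · rintro ⟨r, hr⟩ h
    have h2 := (mem_boolInf hP).2 hr
    rw [h] at h2
    exact h2

theorem boolInf_le_toCompletion_iff (hP : Separative P) {A : Set P} {b : P} :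
    boolInf A ≤ toCompletion b ↔ ∀ r ∈ lowerBounds A, r ≤ b := by
  constructor
  · intro h r hr
    exact (toCompletion_le_toCompletion hP).1 (((toCompletion_le_boolInf hP).2 hr).trans h)
  · intro h r hr
    have := h r ((mem_boolInf hP).1 hr)
    exact mem_toCompletion.2 fun s hs => ⟨s, le_rfl, hs.trans this⟩

variable {A : Ordinal.{0} → Set P} {b : Ordinal.{0} → P}

theorem legalI_iff (hP : Separative P) {α : Ordinal.{0}} : LegalI A b α ↔
    (Order.IsSuccLimit α → A α = ⋃ γ < α, A γ) ∧
    (¬ Order.IsSuccLimit α →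
      (A α).Countable ∧ (∀ γ < α, A γ ⊆ A α) ∧ (lowerBounds (A α)).Nonempty ∧
      ∀ β, α = Order.succ β →
        (∀ r ∈ lowerBounds (A α), r ≤ b β) ∧ ∀ p ∈ A α \ A β, p ≤ b β) := by
  simp only [LegalI, boolInf_ne_bot_iff hP, boolInf_le_toCompletion_iff hP]

theorem legalII_iff (hP : Separative P) {α : Ordinal.{0}} :
    LegalII A b α ↔ b α ∈ lowerBounds (A α) := by
  simp only [LegalII, toCompletion_le_boolInf hP]
  tauto

theorem LegalI.mono {α γ : Ordinal.{0}} (h : LegalI A b α) (hγ : γ ≤ α) : A γ ⊆ A α := by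
  rcases hγ.eq_or_lt with rfl | hγ
  · exact subset_rfl
  by_cases hl : Order.IsSuccLimit α
  · rw [h.1 hl]
    exact Set.subset_iUnion₂ (s := fun γ (_ : γ < α) => A γ) γ hγ
  · exact (h.2 hl).2.1 γ hγ

/-- The answer `b δ` bounds `A δ`, which contains `A (γ + 1)`, and every lower bound of the latter
lies below `b γ`. -/
theorem LegalII.le (hP : Separative P) {γ δ : Ordinal.{0}} (h1 : LegalI A b (Order.succ γ))
    (h2 : LegalI A b δ) (h3 : LegalII A b δ) (h : γ < δ) : b δ ≤ b γ :=
  ((((legalI_iff hP).1 h1).2 (Order.not_isSuccLimit_succ γ)).2.2.2 γ rfl).1 _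
    (lowerBounds_mono_set (h2.mono (Order.succ_le_of_lt h)) ((legalII_iff hP).1 h3))

/-- New elements of a move of Player I lie below all earlier moves of Player II. -/
theorem LegalI.le_of_mem (hP : Separative P) {α γ : Ordinal.{0}}
    (hI : ∀ δ ≤ α, LegalI A b δ) (hII : ∀ δ < α, LegalII A b δ) (hγ : γ < α) {p : P}
    (hp : p ∈ A α) (hp' : p ∉ A γ) : p ≤ b γ := by
  induction α using SuccOrder.limitRecOn with
  | isMin α hα => exact absurd hγ hα.not_lt
  | succ α _ ih =>
    by_cases h : p ∈ A α
    · rcases (Order.lt_succ_iff.1 hγ).eq_or_lt with rfl | h'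
      · exact absurd h hp'
      · exact ih (fun δ hδ => hI δ (hδ.trans (Order.le_succ α)))
          (fun δ hδ => hII δ (hδ.trans (Order.lt_succ α))) h' h
    · have h1 := (((legalI_iff hP).1 (hI _ le_rfl)).2 (Order.not_isSuccLimit_succ α)).2.2.2 α rfl
      refine (h1.2 p ⟨hp, h⟩).trans ?_
      rcases (Order.lt_succ_iff.1 hγ).eq_or_lt with rfl | h'
      · exact le_rfl
      · exact LegalII.le hP (hI _ ((Order.succ_le_of_lt h').trans (Order.le_succ α)))
          (hI _ (Order.le_succ α)) (hII _ (Order.lt_succ α)) h'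
  | isSuccLimit α hα ih =>
    rw [(hI α le_rfl).1 hα] at hp
    simp only [Set.mem_iUnion, exists_prop] at hp
    obtain ⟨δ, hδ, hp⟩ := hp
    have hγδ : γ < δ := by
      by_contra h
      exact hp' ((hI γ hγ.le).mono (not_lt.1 h) hp)
    exact ih δ hδ (fun ε hε => hI ε (hε.trans hδ.le)) (fun ε hε => hII ε (hε.trans hδ)) hγδ hp

/-- When Player II follows a winning operation, only the legality of the moves of Player I has to be
checked, and this under the assumption that all earlier rounds were legal. -/
theorem IsWinning.legal {σ : Set P → Ordinal.{0} → P} (hσ : IsWinning σ)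
    (hb : ∀ α < ω_ 1, b α = σ (A α) α) {o : Ordinal.{0}} (ho : o ≤ ω_ 1)
    (h : ∀ α < o, (∀ γ < α, LegalI A b γ ∧ LegalII A b γ) → LegalI A b α) :
    ∀ α < o, LegalI A b α ∧ LegalII A b α := by
  intro α
  induction α using WellFoundedLT.induction with
  | ind α ih =>
    intro hα
    have h1 : ∀ γ < α, LegalI A b γ ∧ LegalII A b γ := fun γ hγ => ih γ hγ (hγ.trans hα)
    have h2 := h α hα h1
    refine ⟨h2, (hσ A b hb).1 α (hα.trans_le ho) (fun γ hγ => ?_) fun γ hγ => (h1 γ hγ).2⟩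
    rcases hγ.eq_or_lt with rfl | hγ
    · exact h2
    · exact (h1 γ hγ).1

/-- A poset on which Player II has a winning operation is `ω₂`-distributive. -/
theorem IsWinning.exists_below_of_omega_one (hP : Separative P) {σ : Set P → Ordinal.{0} → P}
    (hσ : IsWinning σ) (p : P) (D : Ordinal.{0} → Set P)
    (hD : ∀ ξ < ω_ 1, ∀ q ≤ p, ∃ r ∈ D ξ, r ≤ q) :
    ∃ q ≤ p, ∀ ξ < ω_ 1, ∃ r ∈ D ξ, q ≤ r := by
  have : Nonempty P := ⟨p⟩
  -- Player I plays `p` together with the conditions chosen so far; each new one is taken in `D ξ`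
  -- below the last answer. The final move of Player II is the desired `q`.
  obtain ⟨f, hf⟩ := exists_transfinite_choice
    (fun ξ f y => y ∈ D ξ ∧ y ≤ σ (insert p (f '' Set.Iio ξ)) ξ) (by
      intro α f g h y hy
      rwa [← Set.image_congr (s := Set.Iio α) (fun γ hγ => h γ hγ)])
  let A : Ordinal.{0} → Set P := fun ξ => insert p (f '' Set.Iio ξ)
  let b : Ordinal.{0} → P := fun ξ => σ (A ξ) ξ
  have hfb : ∀ ξ < ω_ 1, LegalII A b ξ → f ξ ∈ D ξ ∧ f ξ ≤ b ξ := by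
    intro ξ hξ h
    exact hf ξ (hD ξ hξ (b ξ) ((legalII_iff hP).1 h (Set.mem_insert _ _)))
  have hmono : ∀ {γ ξ}, γ ≤ ξ → A γ ⊆ A ξ := fun h =>
    Set.insert_subset_insert (Set.image_mono (Set.Iio_subset_Iio h))
  have hlegal : ∀ ξ < ω_ 1, LegalI A b ξ ∧ LegalII A b ξ := by
    refine hσ.legal (fun _ _ => rfl) le_rfl fun ξ hξ ih => (legalI_iff hP).2 ⟨fun hl => ?_, ?_⟩
    · refine subset_antisymm ?_ (Set.iUnion₂_subset fun γ hγ => hmono hγ.le)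
      rintro x (rfl | ⟨γ, hγ, rfl⟩)
      · exact Set.mem_iUnion₂.2 ⟨⊥, hl.bot_lt, Set.mem_insert _ _⟩
      · exact Set.mem_iUnion₂.2 ⟨Order.succ γ, hl.succ_lt hγ,
          Set.mem_insert_of_mem _ ⟨γ, Order.lt_succ γ, rfl⟩⟩
    · intro hl
      refine ⟨((countable_Iio_of_lt hξ).image f).insert p, fun γ hγ => hmono hγ.le, ?_⟩
      have key : ∀ β, ξ = Order.succ β → f β ∈ lowerBounds (A ξ) ∧ f β ≤ b β ∧ f β ∈ A ξ ∧
          ∀ x ∈ A ξ, x ∉ A β → x = f β := by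
        rintro β rfl
        have hβ := ih β (Order.lt_succ β)
        have hfβ := (hfb β ((Order.lt_succ β).trans hξ) hβ.2).2
        have hA : ∀ x ∈ A (Order.succ β), x ∉ A β → x = f β := by
          rintro x (rfl | ⟨γ, hγ, rfl⟩) hx
          · exact absurd (Set.mem_insert _ _) hx
          · rcases (Order.lt_succ_iff.1 (Set.mem_Iio.1 hγ)).eq_or_lt with rfl | h
            · rfl
            · exact absurd (Or.inr ⟨γ, h, rfl⟩) hx
        refine ⟨fun x hx => ?_, hfβ, Or.inr ⟨β, Order.lt_succ β, rfl⟩, hA⟩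
        by_cases h : x ∈ A β
        · exact hfβ.trans ((legalII_iff hP).1 hβ.2 h)
        · rw [hA x hx h]
      refine ⟨?_, fun β hβ => ?_⟩
      · by_cases h : ∃ β, ξ = Order.succ β
        · obtain ⟨β, hβ⟩ := h
          exact ⟨_, (key β hβ).1⟩
        · have h0 : ξ = 0 := by
            by_contra h0
            exact hl ⟨by simpa using h0, fun β hβ => h ⟨β, (Order.succ_eq_of_covBy hβ).symm⟩⟩
          refine ⟨p, ?_⟩
          subst h0
          rintro x (rfl | ⟨γ, hγ, rfl⟩)
          · exact le_rfl
          · exact absurd (Set.mem_Iio.1 hγ) not_lt_zero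
      · obtain ⟨-, h2, h3, h4⟩ := key β hβ
        exact ⟨fun r hr => (hr h3).trans h2, fun x hx => (h4 x hx.1 hx.2).le.trans h2⟩
  obtain ⟨c, hc⟩ := (hσ A b fun _ _ => rfl).2 hlegal
  exact ⟨c, (hc 0 isSuccLimit_omega_one.bot_lt).1 (Set.mem_insert _ _), fun ξ hξ =>
    ⟨f ξ, (hfb ξ hξ (hlegal ξ hξ).2).1, (hc _ (isSuccLimit_omega_one.succ_lt hξ)).1
      (Set.mem_insert_of_mem _ ⟨ξ, Order.lt_succ ξ, rfl⟩)⟩⟩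

theorem IsWinning.exists_below (hP : Separative P) {σ : Set P → Ordinal.{0} → P}
    (hσ : IsWinning σ) (p : P) {ι : Type*} (hι : #ι ≤ ℵ_ 1) (D : ι → Set P)
    (hD : ∀ i, ∀ q ≤ p, ∃ r ∈ D i, r ≤ q) : ∃ q ≤ p, ∀ i, ∃ r ∈ D i, q ≤ r := by
  rcases isEmpty_or_nonempty ι with h | h
  · exact ⟨p, le_rfl, fun i => h.elim i⟩
  · obtain ⟨g, hg⟩ := exists_surjection_from_omega_one ι hι
    obtain ⟨q, hq, h⟩ := hσ.exists_below_of_omega_one hP p (fun ξ => D (g ξ)) fun ξ _ => hD (g ξ)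
    refine ⟨q, hq, fun i => ?_⟩
    obtain ⟨ξ, hξ, rfl⟩ := hg i
    exact h ξ hξ

end Game

/-! ### From the combinatorial principles to the Martin-type axioms -/

section Climb

/-- A new element exceeds all elements of a set cofinal in `α`. -/
theorem EndExtends.le_of_mem {X Y : Set Ordinal.{0}} (h : EndExtends Y X) {α η : Ordinal.{0}}
    (hX : UnboundedIn X α) (hη : η ∈ Y) (hη' : η ∉ X) : α ≤ η := by
  by_contra hlt
  obtain ⟨ξ, hξ, h1, -⟩ := hX η (not_le.1 hlt)
  exact (h.2 η ⟨hη, hη'⟩ ξ hξ).not_gt h1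

/-- The increasing enumeration of a club subset of `β ∩ S²₀` is continuous. -/
theorem IsClubInS20.exists_lt_of_isSuccLimit {g : Ordinal.{0} → Ordinal.{0}} {β ξ η : Ordinal.{0}}
    (hC : IsClubInS20 (g '' Set.Iio (ω_ 1)) β) (hg : StrictMonoOn g (Set.Iio (ω_ 1)))
    (hξ : ξ < ω_ 1) (hl : Order.IsSuccLimit ξ) (hη : η < g ξ) : ∃ γ < ξ, η < g γ := by
  have hmem := hC.1 ⟨ξ, hξ, rfl⟩
  let δ := ⨆ γ : Set.Iio ξ, g γ
  have hle : ∀ γ < ξ, g γ ≤ δ := fun γ hγ => Ordinal.le_iSup (fun γ : Set.Iio ξ => g γ) ⟨γ, hγ⟩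
  have hlt : ∀ γ < ξ, g γ < δ := fun γ hγ =>
    (hg (hγ.trans hξ) ((hl.succ_lt hγ).trans hξ) (Order.lt_succ γ)).trans_le
      (hle _ (hl.succ_lt hγ))
  have hδle : δ ≤ g ξ := Ordinal.iSup_le fun γ => (hg (γ.2.trans hξ) hξ γ.2).le
  have hunb : UnboundedIn (g '' Set.Iio ξ) δ := by
    intro ζ hζ
    obtain ⟨γ, hγ⟩ := (Ordinal.lt_iSup_iff).1 hζ
    exact ⟨g γ, ⟨γ, γ.2, rfl⟩, hγ, hlt γ γ.2⟩
  -- A countable supremum, hence a limit point of the club in `S²₀`. Closure gives `δ = g ζ`, where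
  -- `ζ` cannot be below `ξ`; so `g ξ ≤ δ`.
  have hδS : δ ∈ S20 := hunb.mem_S20 ((countable_Iio_of_lt hξ).image g)
    (hδle.trans_lt hmem.2.1) (bot_lt_iff_ne_bot.1 (bot_le.trans_lt (hlt _ hl.bot_lt)))
  obtain ⟨ζ, hζ, hζδ⟩ := hC.2.2 δ ⟨hδle.trans_lt hmem.1, hδS⟩ fun x hx => by
    obtain ⟨y, ⟨γ, hγ, rfl⟩, h⟩ := hunb x hx
    exact ⟨g γ, ⟨γ, hγ.trans hξ, rfl⟩, h⟩
  have hζξ : ξ ≤ ζ := by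
    by_contra h
    exact (hlt ζ (not_le.1 h)).ne hζδ
  have h2 : g ξ ≤ δ := hζδ ▸ hg.monotoneOn hξ hζ hζξ
  obtain ⟨γ, hγ⟩ := (Ordinal.lt_iSup_iff).1 (hη.trans_le h2)
  exact ⟨γ, γ.2, hγ⟩

/-! ### Lower bounds of descending sequences guided by a winning operation -/

variable {P : Type u} [PartialOrder P] {σ : Set P → Ordinal.{0} → P}

/-- A descending sequence that follows the operation `σ` along a club in `β` has a lower bound. -/
theorem IsWinning.exists_lowerBound_of_club (hP : Separative P) (hσ : IsWinning σ)
    {Cs : Ordinal.{0} → Set Ordinal.{0}} (hCs : IsS20System Cs) {g : Ordinal.{0} → Ordinal.{0}}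
    {β : Ordinal.{0}} (hC : IsClubInS20 (g '' Set.Iio (ω_ 1)) β)
    (hg : StrictMonoOn g (Set.Iio (ω_ 1))) (hE : EndExtendingOn Cs (g '' Set.Iio (ω_ 1)))
    {c : Ordinal.{0} → P} (hc : ∀ δ < β, ∀ γ < δ, c δ ≤ c γ)
    (hcσ : ∀ ξ < ω_ 1, σ (c '' Cs (g ξ)) ξ ∈ lowerBounds (c '' Set.Iio (g ξ)) →
      c (g ξ) = σ (c '' Cs (g ξ)) ξ) : ∃ q, ∀ γ < β, q ≤ c γ := by
  let A : Ordinal.{0} → Set P := fun ξ => c '' Cs (g ξ)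
  let b : Ordinal.{0} → P := fun ξ => σ (A ξ) ξ
  have hmem : ∀ ξ < ω_ 1, g ξ < β ∧ g ξ ∈ S20 := fun ξ hξ => hC.1 ⟨ξ, hξ, rfl⟩
  have hsys : ∀ ξ < ω_ 1, (Cs (g ξ)).Countable ∧ Cs (g ξ) ⊆ Set.Iio (g ξ) ∧
      UnboundedIn (Cs (g ξ)) (g ξ) := fun ξ hξ => hCs _ (hmem ξ hξ).2
  have hext : ∀ ξ < ω_ 1, ∀ γ < ξ, EndExtends (Cs (g ξ)) (Cs (g γ)) := fun ξ hξ γ hγ =>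
    hE _ ⟨γ, hγ.trans hξ, rfl⟩ _ ⟨ξ, hξ, rfl⟩ (hg (hγ.trans hξ) hξ hγ)
  have hnew : ∀ ξ < ω_ 1, ∀ γ < ξ, ∀ η ∈ Cs (g ξ), η ∉ Cs (g γ) → g γ ≤ η :=
    fun ξ hξ γ hγ η hη hη' => (hext ξ hξ γ hγ).le_of_mem (hsys γ (hγ.trans hξ)).2.2 hη hη'
  -- Since `Cs (g ξ)` is cofinal in `g ξ`, a lower bound of the move `A ξ` bounds all conditions
  -- before `g ξ`, which is what `hcσ` asks for.
  have hbc : ∀ ξ < ω_ 1, LegalII A b ξ → c (g ξ) = b ξ := by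
    intro ξ hξ h
    refine hcσ ξ hξ ?_
    rintro _ ⟨γ, hγ, rfl⟩
    obtain ⟨η, hη, h1, h2⟩ := (hsys ξ hξ).2.2 γ hγ
    exact ((legalII_iff hP).1 h ⟨η, hη, rfl⟩).trans (hc η (h2.trans (hmem ξ hξ).1) γ h1)
  have hcle : ∀ δ < β, ∀ γ ≤ δ, c δ ≤ c γ := by
    intro δ hδ γ hγ
    rcases hγ.eq_or_lt with rfl | h
    · exact le_rfl
    · exact hc δ hδ γ h
  have hlegal : ∀ ξ < ω_ 1, LegalI A b ξ ∧ LegalII A b ξ := by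
    refine hσ.legal (fun _ _ => rfl) le_rfl fun ξ hξ ih => (legalI_iff hP).2 ⟨fun hl => ?_, ?_⟩
    · refine subset_antisymm ?_ (Set.iUnion₂_subset fun γ hγ => Set.image_mono (hext ξ hξ γ hγ).1)
      rintro _ ⟨η, hη, rfl⟩
      obtain ⟨γ, hγ, h⟩ := hC.exists_lt_of_isSuccLimit hg hξ hl ((hsys ξ hξ).2.1 hη)
      refine Set.mem_iUnion₂.2 ⟨γ, hγ, η, ?_, rfl⟩
      by_contra h2
      exact (hnew ξ hξ γ hγ η hη h2).not_gt h
    · intro _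
      refine ⟨(hsys ξ hξ).1.image c, fun γ hγ => Set.image_mono (hext ξ hξ γ hγ).1,
        ⟨c (g ξ), ?_⟩, ?_⟩
      · rintro _ ⟨η, hη, rfl⟩
        exact hc _ (hmem ξ hξ).1 _ ((hsys ξ hξ).2.1 hη)
      -- The rules at a successor: `Cs (g (ζ + 1))` has an element above `g ζ`, so the infimum lies
      -- below `c (g ζ) = b ζ`; and its new elements have index at least `g ζ`.
      · rintro ζ rfl
        have hζ := Order.lt_succ ζ
        rw [show σ (A ζ) ζ = c (g ζ) from (hbc ζ (hζ.trans hξ) (ih ζ hζ).2).symm]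
        constructor
        · intro r hr
          obtain ⟨η, hη, h1, h2⟩ := (hsys _ hξ).2.2 (g ζ) (hg (hζ.trans hξ) hξ hζ)
          exact (hr ⟨η, hη, rfl⟩).trans (hc η (h2.trans (hmem _ hξ).1) _ h1)
        · rintro _ ⟨⟨η, hη, rfl⟩, h2⟩
          exact hcle η (((hsys _ hξ).2.1 hη).trans (hmem _ hξ).1) _
            (hnew _ hξ ζ hζ η hη fun h3 => h2 ⟨η, h3, rfl⟩)
  obtain ⟨q, hq⟩ := (hσ A b fun _ _ => rfl).2 hlegal
  refine ⟨q, fun γ hγ => ?_⟩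
  obtain ⟨_, ⟨ξ, hξ, rfl⟩, h1, h2⟩ := hC.2.1 γ hγ
  refine (hq ξ hξ).2.trans ?_
  rw [← hbc ξ hξ (hlegal ξ hξ).2]
  exact hc _ h2 _ h1

/-- A descending sequence of length in `S²₀` has a lower bound if at each step all the finite plays
with auxiliary conditions from the sets `N γ` are taken care of. -/
theorem IsWinning.exists_lowerBound_of_mem_S20 (hP : Separative P) (hσ : IsWinning σ)
    {α : Ordinal.{0}} (hα : α ∈ S20) {c : Ordinal.{0} → P} {N : Ordinal.{0} → Set P}
    (hc : ∀ δ < α, ∀ γ < δ, c δ ≤ c γ)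
    (hN : ∀ δ < α, ∀ l : List P, (∀ x ∈ l, ∃ γ ≤ δ, x ∈ N γ) → ∃ q ∈ N (Order.succ δ), q ≤ c δ ∧
      (σ (insert q {x | x ∈ l}) l.length ≤ q →
        c (Order.succ δ) ≤ σ (insert q {x | x ∈ l}) l.length)) :
    ∃ q, ∀ γ < α, q ≤ c γ := by
  obtain ⟨a, hmono, hlt, hcof⟩ := exists_sequence_of_mem_S20 hα
  have hcle : ∀ δ < α, ∀ γ ≤ δ, c δ ≤ c γ := by
    intro δ hδ γ hγ
    rcases hγ.eq_or_lt with rfl | h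
    · exact le_rfl
    · exact hc δ hδ γ h
  have hex : ∀ (δ : Ordinal.{0}) (l : List P), ∃ q, δ < α → (∀ x ∈ l, ∃ γ ≤ δ, x ∈ N γ) →
      q ∈ N (Order.succ δ) ∧ q ≤ c δ ∧ (σ (insert q {x | x ∈ l}) l.length ≤ q →
        c (Order.succ δ) ≤ σ (insert q {x | x ∈ l}) l.length) := by
    intro δ l
    by_cases h : δ < α ∧ ∀ x ∈ l, ∃ γ ≤ δ, x ∈ N γ
    · obtain ⟨q, hq⟩ := hN δ h.1 l h.2
      exact ⟨q, fun _ _ => hq⟩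
    -- A default value, so that `Q` becomes a total function.
    · exact ⟨c 0, fun h1 h2 => absurd ⟨h1, h2⟩ h⟩
  choose Q hQ using hex
  -- `l n` lists `q (n - 1), …, q 0`, so its length is the number of the round in which `q n` is
  -- added.
  let l : ℕ → List P := fun n => Nat.rec [] (fun n l => Q (a n) l :: l) n
  let q : ℕ → P := fun n => Q (a n) (l n)
  have hl : ∀ n, l (n + 1) = q n :: l n := fun n => rfl
  have hlen : ∀ n, (l n).length = n := by
    intro n
    induction n with
    | zero => rfl
    | succ n ih => rw [hl, List.length_cons, ih]
  have hsucc : ∀ n, Order.succ (a n) ≤ a (n + 1) := fun n =>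
    Order.succ_le_of_lt (hmono n.lt_succ_self)
  have hlN : ∀ n, ∀ x ∈ l n, ∃ γ ≤ a n, x ∈ N γ := by
    intro n
    induction n with
    | zero => intro x hx; exact absurd hx List.not_mem_nil
    | succ n ih =>
      intro x hx
      rw [hl, List.mem_cons] at hx
      rcases hx with rfl | hx
      · exact ⟨_, hsucc n, (hQ (a n) (l n) (hlt n) ih).1⟩
      · obtain ⟨γ, hγ, h⟩ := ih x hx
        exact ⟨γ, hγ.trans (hmono n.lt_succ_self).le, h⟩
  have hq := fun n => hQ (a n) (l n) (hlt n) (hlN n)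
  let A : Ordinal.{0} → Set P := fun o => {x | ∃ n : ℕ, (n : Ordinal.{0}) ≤ o ∧ x = q n}
  let b : Ordinal.{0} → P := fun o => σ (A o) o
  have hlA : ∀ n : ℕ, insert (q n) {x | x ∈ l n} = A n := by
    intro n
    induction n with
    | zero =>
      ext x
      simp [A, l]
    | succ n ih =>
      have h : {x | x ∈ l (n + 1)} = A n := by
        rw [← ih, hl]
        ext x
        simp
      rw [h]
      ext x
      simp only [A, Set.mem_insert_iff, Set.mem_ofPred_eq, Nat.cast_le]
      constructor
      · rintro (rfl | ⟨m, hm, rfl⟩)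
        · exact ⟨n + 1, le_rfl, rfl⟩
        · exact ⟨m, hm.trans n.le_succ, rfl⟩
      · rintro ⟨m, hm, rfl⟩
        rcases hm.eq_or_lt with rfl | hm
        · exact Or.inl rfl
        · exact Or.inr ⟨m, Nat.lt_succ_iff.1 hm, rfl⟩
  have hmem : ∀ n : ℕ, q n ∈ A n := fun n => ⟨n, le_rfl, rfl⟩
  -- Interleaving: `q (n + 1)` lies below `c (a (n + 1))`, hence below `c (a n + 1)`, which was
  -- chosen below the answer to this very finite play.
  have hcb : ∀ n : ℕ, LegalII A b n → q (n + 1) ≤ b n := by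
    intro n h
    have h1 := (hq n).2.2
    rw [hlen, hlA] at h1
    exact ((hq (n + 1)).2.1.trans (hcle _ (hlt _) _ (hsucc n))).trans
      (h1 ((legalII_iff hP).1 h (hmem n)))
  have hAmono : ∀ {o o'}, o ≤ o' → A o ⊆ A o' := by
    rintro o o' h x ⟨n, hn, rfl⟩
    exact ⟨n, hn.trans h, rfl⟩
  -- The play is followed only through round `ω`; the answer given there lies below all `q n`, hence
  -- below a cofinal part of the sequence.
  have hω : Order.succ ω ≤ ω_ 1 := Order.succ_le_of_lt omega0_lt_omega_one
  have hlegal : ∀ ξ < Order.succ ω, LegalI A b ξ ∧ LegalII A b ξ := by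
    refine hσ.legal (fun _ _ => rfl) hω fun ξ hξ ih => (legalI_iff hP).2 ⟨fun hl => ?_, fun hl => ?_⟩
    · refine subset_antisymm ?_ (Set.iUnion₂_subset fun γ hγ => hAmono hγ.le)
      rintro _ ⟨n, hn, rfl⟩
      exact Set.mem_iUnion₂.2 ⟨n, (natCast_lt_omega0 n).trans_le (omega0_le_of_isSuccLimit hl),
        hmem n⟩
    · have hξω : ξ < ω := (Order.lt_succ_iff.1 hξ).lt_of_ne fun h => hl (h ▸ isSuccLimit_omega0)
      obtain ⟨n, rfl⟩ := lt_omega0.1 hξω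
      have key : q n ∈ lowerBounds (A n) ∧ ∀ m, n = m + 1 → q n ≤ b m ∧
          ∀ p ∈ A n, p ∉ A m → p = q n := by
        cases n with
        | zero =>
          refine ⟨?_, fun m h => absurd h (by omega)⟩
          rintro _ ⟨m, hm, rfl⟩
          rw [Nat.cast_le, Nat.le_zero] at hm
          rw [hm]
        | succ n =>
          have hn : ((n : ℕ) : Ordinal.{0}) < ((n + 1 : ℕ) : Ordinal.{0}) := by
            exact_mod_cast n.lt_succ_self
          have h1 := hcb n (ih n hn).2
          have h2 : ∀ p ∈ A (n + 1 : ℕ), p ∉ A n → p = q (n + 1) := by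
            rintro _ ⟨m, hm, rfl⟩ hp
            rw [Nat.cast_le] at hm
            rcases hm.eq_or_lt with rfl | hm
            · rfl
            · exact absurd ⟨m, by exact_mod_cast Nat.lt_succ_iff.1 hm, rfl⟩ hp
          constructor
          · intro p hp
            by_cases h : p ∈ A n
            · exact h1.trans ((legalII_iff hP).1 (ih n hn).2 h)
            · rw [h2 p hp h]
          · intro m hm
            obtain rfl : n = m := by omega
            exact ⟨h1, h2⟩
      refine ⟨?_, fun γ hγ => hAmono hγ.le, ⟨_, key.1⟩, fun β hβ => ?_⟩
      · refine (Set.countable_range q).mono ?_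
        rintro _ ⟨m, -, rfl⟩
        exact ⟨m, rfl⟩
      · obtain ⟨m, rfl⟩ := lt_omega0.1 ((hβ ▸ Order.lt_succ β).trans hξω)
        have hnm : n = m + 1 := by
          rw [Order.succ_eq_add_one] at hβ
          exact_mod_cast hβ
        obtain ⟨h1, h2⟩ := key.2 m hnm
        exact ⟨fun r hr => (hr (hmem n)).trans h1, fun p hp => (h2 p hp.1 hp.2).le.trans h1⟩
  refine ⟨b ω, fun γ hγ => ?_⟩
  obtain ⟨n, hn⟩ := hcof γ hγ
  have h := (legalII_iff hP).1 (hlegal ω (Order.lt_succ ω)).2 ⟨n, (natCast_lt_omega0 n).le, rfl⟩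
  exact (h.trans (hq n).2.1).trans (hc _ (hlt n) _ hn)

/-- There are at most `ℵ₁` finite lists from `S`, so distributivity meets `D` and handles all the
lists at once. For a given list the requirement is dense: below any `q`, either the answer to the
move obtained by adding `q` is a legal extension, or the implication is vacuous and `q` itself
serves. -/
theorem IsWinning.exists_step (hP : Separative P) (hσ : IsWinning σ) (p : P) {S : Set P}
    (hS : #S ≤ ℵ_ 1) {D : Set P} (hD : ∀ q, ∃ r ∈ D, r ≤ q) :
    ∃ y : P × Set P, y.1 ≤ p ∧ #y.2 ≤ ℵ_ 1 ∧ (∃ r ∈ D, y.1 ≤ r) ∧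
      ∀ l : List P, (∀ x ∈ l, x ∈ S) → ∃ q ∈ y.2, q ≤ p ∧
        (σ (insert q {x | x ∈ l}) l.length ≤ q → y.1 ≤ σ (insert q {x | x ∈ l}) l.length) := by
  have hι : #(Option (List S)) ≤ ℵ_ 1 := by
    rw [Cardinal.mk_option]
    refine Cardinal.add_le_of_le (Cardinal.aleph0_le_aleph 1) ?_
      (one_le_aleph0.trans (Cardinal.aleph0_le_aleph 1))
    exact (Cardinal.mk_list_le_max _).trans (max_le (Cardinal.aleph0_le_aleph 1) hS)
  let s : List S → List P := List.map Subtype.val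
  obtain ⟨y, hyp, hy⟩ := hσ.exists_below hP p hι
    (fun i : Option (List S) => i.elim D fun l => {r | ∃ q ≤ p,
      (σ (insert q {x | x ∈ s l}) (s l).length ≤ q → r ≤ σ (insert q {x | x ∈ s l}) (s l).length)})
    (by
      rintro (_ | l) q hq
      · exact hD q
      · by_cases h : σ (insert q {x | x ∈ s l}) (s l).length ≤ q
        · exact ⟨_, ⟨q, hq, fun _ => le_rfl⟩, h⟩
        · exact ⟨q, ⟨q, hq, fun h' => absurd h' h⟩, le_rfl⟩)
  have hy2 : ∀ l : List S, ∃ q ≤ p, (σ (insert q {x | x ∈ s l}) (s l).length ≤ q →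
      y ≤ σ (insert q {x | x ∈ s l}) (s l).length) := by
    intro l
    obtain ⟨r, ⟨q, hq, h⟩, hr⟩ := hy (some l)
    exact ⟨q, hq, fun h' => hr.trans (h h')⟩
  choose Q hQ1 hQ2 using hy2
  refine ⟨(y, Set.range Q), hyp, ?_, hy none, fun l hl => ?_⟩
  · exact Cardinal.mk_range_le.trans ((Cardinal.mk_le_of_injective (Option.some_injective _)).trans hι)
  · lift l to List S using hl
    exact ⟨Q l, ⟨l, rfl⟩, hQ1 l, hQ2 l⟩

theorem mk_biUnion_Iio_le_aleph_one {α : Type u} {δ : Ordinal.{0}} (hδ : δ < ω_ 2)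
    (N : Ordinal.{0} → Set α) (hN : ∀ γ < δ, #(N γ) ≤ ℵ_ 1) :
    #(⋃ γ ∈ Set.Iio δ, N γ : Set α) ≤ ℵ_ 1 := by
  rw [← Cardinal.lift_le.{1}]
  refine (Cardinal.mk_biUnion_le_lift N (Set.Iio δ)).trans ?_
  have h1 : Cardinal.lift.{u} #(Set.Iio δ) ≤ ℵ_ 1 := by
    rw [Cardinal.mk_Iio_ordinal, Cardinal.lift_lift]
    exact (Cardinal.lift_le.2 (card_le_aleph_one_of_lt hδ)).trans_eq (by simp)
  have h2 : (⨆ x : Set.Iio δ, Cardinal.lift.{1} #(N x)) ≤ ℵ_ 1 :=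
    ciSup_le' fun x => by simpa using hN x x.2
  simpa using Cardinal.mul_le_of_le (Cardinal.aleph0_le_aleph 1) h1 h2

/-- If `σ` is a winning operation which cannot distinguish `f α` from the index of `α` in the clubs
provided by the system `Cs`, then `MA_{ω₂}` holds for the poset. -/
theorem IsWinning.ma (hP : Separative P) (hσ : IsWinning σ)
    {Cs : Ordinal.{0} → Set Ordinal.{0}} {f : Ordinal.{0} → Ordinal.{0}} (hCs : IsS20System Cs)
    (hS : ∀ β ∈ S21, ∃ C : Set Ordinal.{0}, IsClubInS20 C β ∧ otp C = ω_ 1 ∧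
      (∀ α ∈ C, ∀ ξ, Ordinal.lift.{1} ξ = otp (C ∩ Set.Iio α) → ∀ A, σ A (f α) = σ A ξ) ∧
      EndExtendingOn Cs C) : MA P (ω_ 2) := by
  intro p D hD
  -- The first coordinate is the descending sequence, the second the auxiliary conditions
  -- contributed at that stage. The fourth clause serves the dense sets and the limits in `S²₀`, the
  -- last one the limits in `S²₁`.
  let R : Ordinal.{0} → (Ordinal.{0} → P × Set P) → P × Set P → Prop := fun α F y =>
    (∀ γ < α, y.1 ≤ (F γ).1) ∧ y.1 ≤ p ∧ #y.2 ≤ ℵ_ 1 ∧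
    (∀ δ, α = Order.succ δ → (∃ r ∈ D δ, y.1 ≤ r) ∧
      ∀ l : List P, (∀ x ∈ l, ∃ γ ≤ δ, x ∈ (F γ).2) → ∃ q ∈ y.2, q ≤ (F δ).1 ∧
        (σ (insert q {x | x ∈ l}) l.length ≤ q → y.1 ≤ σ (insert q {x | x ∈ l}) l.length)) ∧
    (α ∈ S20 → σ ((fun γ => (F γ).1) '' Cs α) (f α) ∈
        lowerBounds ((fun γ => (F γ).1) '' Set.Iio α) →
      y.1 = σ ((fun γ => (F γ).1) '' Cs α) (f α))
  have : Nonempty (P × Set P) := ⟨(p, ∅)⟩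
  obtain ⟨F, hF⟩ := exists_transfinite_choice R (by
    rintro α F G h y ⟨h1, h2, h3, h4, h5⟩
    refine ⟨fun γ hγ => h γ hγ ▸ h1 γ hγ, h2, h3, ?_, fun hα => ?_⟩
    · rintro δ rfl
      refine ⟨(h4 δ rfl).1, fun l hl => ?_⟩
      rw [← h δ (Order.lt_succ δ)]
      refine (h4 δ rfl).2 l fun x hx => ?_
      obtain ⟨γ, hγ, hx⟩ := hl x hx
      exact ⟨γ, hγ, (h γ (Order.lt_succ_iff.2 hγ)).symm ▸ hx⟩
    · have e1 : (fun γ => (F γ).1) '' Set.Iio α = (fun γ => (G γ).1) '' Set.Iio α :=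
        Set.image_congr fun γ hγ => congrArg Prod.fst (h γ hγ)
      have e2 : (fun γ => (F γ).1) '' Cs α = (fun γ => (G γ).1) '' Cs α :=
        Set.image_congr fun γ hγ => congrArg Prod.fst (h γ ((hCs α hα).2.1 hγ))
      rw [← e1, ← e2]
      exact h5 hα)
  have key : ∀ α < ω_ 2, R α F (F α) := by
    intro α
    induction α using WellFoundedLT.induction with
    | ind α ih =>
      intro hα
      have ih' : ∀ γ < α, R γ F (F γ) := fun γ hγ => ih γ hγ (hγ.trans hα)
      have hdesc : ∀ δ < α, ∀ γ < δ, (F δ).1 ≤ (F γ).1 := fun δ hδ => (ih' δ hδ).1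
      apply hF
      by_cases hl : Order.IsSuccLimit α
      · have hlb : ∃ q, ∀ γ < α, q ≤ (F γ).1 := by
          rcases mem_S20_or_mem_S21 hα hl with h | h
          · refine hσ.exists_lowerBound_of_mem_S20 hP h (c := fun γ => (F γ).1)
              (N := fun γ => (F γ).2) hdesc fun δ hδ l hl' => ?_
            exact ((ih' _ (hl.succ_lt hδ)).2.2.2.1 δ rfl).2 l hl'
          · obtain ⟨C, hC, ho, hf, hE⟩ := hS α h
            obtain ⟨g, hg, rfl⟩ := exists_enumeration ho
            refine hσ.exists_lowerBound_of_club hP hCs hC hg hE (c := fun γ => (F γ).1) hdesc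
              fun ξ hξ hlow => ?_
            have hmem := hC.1 ⟨ξ, hξ, rfl⟩
            have e := hf (g ξ) ⟨ξ, hξ, rfl⟩ ξ (otp_image_inter_Iio hg hξ).symm
            rw [← e] at hlow ⊢
            exact (ih' (g ξ) hmem.1).2.2.2.2 hmem.2 hlow
        obtain ⟨q, hq⟩ := hlb
        have hnot : ∀ δ, α ≠ Order.succ δ := fun δ h => Order.not_isSuccLimit_succ δ (h ▸ hl)
        have hle : ∀ q : P, (∀ γ < α, q ≤ (F γ).1) → q ≤ p := fun q hq =>
          (hq ⊥ hl.bot_lt).trans (ih' ⊥ hl.bot_lt).2.1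
        have h0 : #((∅ : Set P)) ≤ ℵ_ 1 := by simp
        -- The operation is followed only when its value is a lower bound; otherwise the `q` found
        -- above continues the sequence. Limits contribute no auxiliary conditions.
        by_cases hs : σ ((fun γ => (F γ).1) '' Cs α) (f α) ∈
            lowerBounds ((fun γ => (F γ).1) '' Set.Iio α)
        · have hs' : ∀ γ < α, σ ((fun γ => (F γ).1) '' Cs α) (f α) ≤ (F γ).1 :=
            fun γ hγ => hs ⟨γ, hγ, rfl⟩
          exact ⟨(_, ∅), hs', hle _ hs', h0, fun δ h => absurd h (hnot δ), fun _ _ => rfl⟩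
        · exact ⟨(q, ∅), hq, hle _ hq, h0, fun δ h => absurd h (hnot δ), fun _ h => absurd h hs⟩
      · have hS20 : α ∉ S20 := fun h => hl (isSuccLimit_of_mem_S20 h)
        by_cases h : ∃ δ, α = Order.succ δ
        · obtain ⟨δ, rfl⟩ := h
          have hδ := Order.lt_succ δ
          obtain ⟨y, hy1, hy2, hy3, hy4⟩ := hσ.exists_step hP (F δ).1
            (mk_biUnion_Iio_le_aleph_one hα (fun γ => (F γ).2) fun γ hγ => (ih' γ hγ).2.2.1)
            (hD δ (hδ.trans hα))
          refine ⟨y, fun γ hγ => ?_, hy1.trans (ih' δ hδ).2.1, hy2, fun ζ hζ => ?_,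
            fun h => absurd h hS20⟩
          · rcases (Order.lt_succ_iff.1 hγ).eq_or_lt with rfl | h
            · exact hy1
            · exact hy1.trans (hdesc δ hδ γ h)
          · obtain rfl := Order.succ_injective hζ
            refine ⟨hy3, fun l hl' => hy4 l fun x hx => ?_⟩
            obtain ⟨γ, hγ, hx⟩ := hl' x hx
            exact Set.mem_iUnion₂.2 ⟨γ, Order.lt_succ_iff.2 hγ, hx⟩
        · have h0 : IsMin α := by
            by_contra h0
            exact hl ⟨h0, fun β hβ => h ⟨β, (Order.succ_eq_of_covBy hβ).symm⟩⟩
          exact ⟨(p, ∅), fun γ hγ => absurd hγ h0.not_lt, le_rfl, by simp,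
            fun δ hδ => absurd ⟨δ, hδ⟩ h, fun h => absurd h hS20⟩
  have hanti : ∀ γ δ : Ordinal.{0}, γ ≤ δ → δ < ω_ 2 → (F δ).1 ≤ (F γ).1 := by
    intro γ δ h hδ
    rcases h.eq_or_lt with rfl | h
    · exact le_rfl
    · exact (key δ hδ).1 γ h
  have hF : Order.IsPFilter {x : P | ∃ γ < ω_ 2, (F γ).1 ≤ x} := by
    refine Order.IsPFilter.of_def ⟨_, 0, isSuccLimit_omega_two.bot_lt, le_rfl⟩ ?_ ?_
    · rintro x ⟨γ, hγ, hx⟩ y ⟨δ, hδ, hy⟩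
      rcases le_total γ δ with h | h
      · exact ⟨(F δ).1, ⟨δ, hδ, le_rfl⟩, (hanti γ δ h hδ).trans hx, hy⟩
      · exact ⟨(F γ).1, ⟨γ, hγ, le_rfl⟩, hx, (hanti δ γ h hγ).trans hy⟩
    · rintro x y hxy ⟨γ, hγ, hx⟩
      exact ⟨γ, hγ, hx.trans hxy⟩
  refine ⟨hF.toPFilter, ⟨0, isSuccLimit_omega_two.bot_lt,
    (key 0 isSuccLimit_omega_two.bot_lt).2.1⟩, fun α hα => ?_⟩
  have hsucc := isSuccLimit_omega_two.succ_lt hα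
  obtain ⟨r, hr, h⟩ := ((key _ hsucc).2.2.2.1 α rfl).1
  exact ⟨r, hr, Order.succ α, hsucc, h⟩

end Climb

theorem SCLeMinus.maClass (h : SCLeMinus) : MAClass.{u} (ω_ 2) TacticallyClosed := by
  obtain ⟨Cs, hCs, hS⟩ := h
  rintro P _ ⟨hP, τ, hτ⟩
  -- A tactic ignores the round, so any `f` satisfies the requirement of indistinguishability.
  refine hτ.ma (f := fun _ => 0) hP hCs fun β hβ => ?_
  obtain ⟨C, h1, h2, h3⟩ := hS β hβ
  exact ⟨C, h1, h2, fun _ _ _ _ _ => rfl, h3⟩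

theorem SCLe.maClass (h : SCLe) : MAClass.{u} (ω_ 2) OperationallyClosed := by
  obtain ⟨f, Cs, -, hCs, hS⟩ := h
  rintro P _ ⟨hP, σ, hσ⟩
  refine hσ.ma (f := f) hP hCs fun β hβ => ?_
  obtain ⟨C, h1, h2, h3, h4⟩ := hS β hβ
  refine ⟨C, h1, h2, fun α hα ξ hξ A => ?_, h4⟩
  rw [Ordinal.lift_inj.1 ((h3 α hα).trans hξ.symm)]

/-! ### Invariance under order isomorphisms -/

section Transfer

variable {P : Type u} {Q : Type v} [PartialOrder P] [PartialOrder Q]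

theorem Separative.of_orderIso (hQ : Separative Q) (e : P ≃o Q) : Separative P := by
  intro p q hpq
  obtain ⟨r, hr, h⟩ := hQ (e p) (e q) fun h => hpq (e.le_iff_le.1 h)
  refine ⟨e.symm r, e.symm_apply_le.2 hr, ?_⟩
  rintro ⟨s, hs, hs'⟩
  exact h ⟨e s, e.le_symm_apply.1 hs, e.monotone hs'⟩

theorem LegalI.map (hP : Separative P) (hQ : Separative Q) (e : P ≃o Q)
    {A : Ordinal.{0} → Set P} {b : Ordinal.{0} → P} {α : Ordinal.{0}} (h : LegalI A b α) :
    LegalI (fun ξ => e '' A ξ) (fun ξ => e (b ξ)) α := by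
  rw [legalI_iff hP] at h
  refine (legalI_iff hQ).2 ⟨fun hl => ?_, fun hl => ?_⟩
  · simp only [h.1 hl, Set.image_iUnion₂]
  · obtain ⟨h1, h2, ⟨r, hr⟩, h4⟩ := h.2 hl
    refine ⟨h1.image e, fun γ hγ => Set.image_mono (h2 γ hγ), ⟨e r, ?_⟩, fun β hβ => ⟨?_, ?_⟩⟩
    · rintro _ ⟨x, hx, rfl⟩
      exact e.monotone (hr hx)
    · intro s hs
      refine e.symm_apply_le.1 ((h4 β hβ).1 _ fun x hx => ?_)
      exact e.symm_apply_le.2 (hs ⟨x, hx, rfl⟩)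
    · rintro _ ⟨⟨x, hx, rfl⟩, hx'⟩
      exact e.monotone ((h4 β hβ).2 x ⟨hx, fun h => hx' ⟨x, h, rfl⟩⟩)

theorem legalII_map_iff (hP : Separative P) (hQ : Separative Q) (e : P ≃o Q)
    {A : Ordinal.{0} → Set P} {b : Ordinal.{0} → P} {α : Ordinal.{0}} :
    LegalII (fun ξ => e '' A ξ) (fun ξ => e (b ξ)) α ↔ LegalII A b α := by
  rw [legalII_iff hP, legalII_iff hQ]
  simp [lowerBounds]

theorem IsWinning.of_orderIso (hQ : Separative Q) (e : P ≃o Q) {σ : Set Q → Ordinal.{0} → Q}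
    (hσ : IsWinning σ) : IsWinning fun (A : Set P) α => e.symm (σ (e '' A) α) := by
  have hP := hQ.of_orderIso e
  intro A b hb
  have h := hσ (fun ξ => e '' A ξ) (fun ξ => e (b ξ)) fun α hα => by simp [hb α hα]
  refine ⟨fun α hα h1 h2 => ?_, fun h1 => ?_⟩
  · exact (legalII_map_iff hP hQ e).1 (h.1 α hα (fun γ hγ => (h1 γ hγ).map hP hQ e)
      fun γ hγ => (legalII_map_iff hP hQ e).2 (h2 γ hγ))
  · obtain ⟨c, hc⟩ := h.2 fun α hα =>
      ⟨(h1 α hα).1.map hP hQ e, (legalII_map_iff hP hQ e).2 (h1 α hα).2⟩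
    exact ⟨e.symm c, fun α hα => ⟨fun x hx => e.symm_apply_le.2 ((hc α hα).1 ⟨x, hx, rfl⟩),
      e.symm_apply_le.2 (hc α hα).2⟩⟩

theorem MA.of_orderIso {lam : Ordinal.{0}} (h : MA P lam) (e : P ≃o Q) : MA Q lam := by
  intro p D hD
  obtain ⟨F, hp, hF⟩ := h (e.symm p) (fun α => e ⁻¹' D α) fun α hα q => by
    obtain ⟨r, hr, h⟩ := hD α hα (e q)
    exact ⟨e.symm r, by simpa using hr, e.symm_apply_le.2 h⟩
  have hG : Order.IsPFilter {x : Q | e.symm x ∈ F} := by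
    refine Order.IsPFilter.of_def ⟨p, hp⟩ ?_ ?_
    · intro x hx y hy
      obtain ⟨z, hz, h1, h2⟩ := F.directed _ hx _ hy
      exact ⟨e z, by simpa using hz, e.le_symm_apply.1 h1, e.le_symm_apply.1 h2⟩
    · intro x y hxy hx
      exact F.mem_of_le (e.symm.monotone hxy) hx
  refine ⟨hG.toPFilter, hp, fun α hα => ?_⟩
  obtain ⟨r, hr, h⟩ := hF α hα
  exact ⟨e r, hr, show e.symm (e r) ∈ F by simpa using h⟩

/-- `Cond w` lives in `Type 1`, whereas the axioms speak of posets in `Type u`; this moves it to the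
right universe. -/
theorem exists_orderIso_of_small (Q : Type v) [PartialOrder Q] [Small.{u} Q] :
    ∃ (P : Type u) (_ : PartialOrder P), Nonempty (P ≃o Q) := by
  let f := (equivShrink Q).symm
  let o : PartialOrder (Shrink.{u} Q) := PartialOrder.lift f f.injective
  exact ⟨Shrink.{u} Q, o, ⟨{ toEquiv := f, map_rel_iff' := Iff.rfl }⟩⟩

end Transfer

/-! ### The poset of initial segments of a system -/

/-- `β` is a good point for the sequence `v` of pairs `⟨C_α, f α⟩`; the function `f` is taken into
account only if `w` holds. -/
def GoodAt (w : Prop) (v : Ordinal.{0} → Set Ordinal.{0} × Ordinal.{0}) (β : Ordinal.{0}) : Prop :=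
  ∃ C : Set Ordinal.{0}, IsClubInS20 C β ∧ otp C = ω_ 1 ∧
    (w → ∀ α ∈ C, Ordinal.lift.{1} (v α).2 = otp (C ∩ Set.Iio α)) ∧
    EndExtendingOn (fun α => (v α).1) C

theorem GoodAt.congr {w : Prop} {v v' : Ordinal.{0} → Set Ordinal.{0} × Ordinal.{0}}
    {β : Ordinal.{0}} (h : GoodAt w v β) (hv : ∀ α < β, v α = v' α) : GoodAt w v' β := by
  obtain ⟨C, h1, h2, h3, h4⟩ := h
  have hC : ∀ α ∈ C, v α = v' α := fun α hα => hv α (h1.1 hα).1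
  refine ⟨C, h1, h2, fun hw α hα => hC α hα ▸ h3 hw α hα, fun α hα α' hα' hlt => ?_⟩
  have := h4 α hα α' hα' hlt
  simp only [hC α hα, hC α' hα'] at this
  exact this

/-- Admissible values `⟨C_α, f α⟩`. -/
def IsValue (α : Ordinal.{0}) (x : Set Ordinal.{0} × Ordinal.{0}) : Prop :=
  x.1.Countable ∧ x.1 ⊆ Set.Iio α ∧ (α ∈ S20 → UnboundedIn x.1 α) ∧ x.2 < ω_ 1

theorem exists_isValue (α : Ordinal.{0}) : ∃ x, IsValue α x := by
  by_cases h : α ∈ S20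
  · obtain ⟨X, h1, h2, h3⟩ := exists_countable_unbounded h
    exact ⟨(X, 0), h1, h2, fun _ => h3, isSuccLimit_omega_one.bot_lt⟩
  · exact ⟨(∅, 0), Set.countable_empty, Set.empty_subset _, fun h' => absurd h' h,
      isSuccLimit_omega_one.bot_lt⟩

/-- Initial segments of length less than `ω₂` of systems as in the definitions of `SCLₑ` (if `w`
holds) and of `SCL⁻ₑ` (otherwise). -/
@[ext]
structure Cond (w : Prop) where
  len : Ordinal.{0}
  val : Ordinal.{0} → Set Ordinal.{0} × Ordinal.{0}
  len_lt : len < ω_ 2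
  val_of_le : ∀ α, len ≤ α → val α = (∅, 0)
  isValue : ∀ α < len, IsValue α (val α)
  good : ∀ β ∈ S21, β ≤ len → GoodAt w val β

namespace Cond

variable {w : Prop}

instance : PartialOrder (Cond w) where
  le p q := q.len ≤ p.len ∧ ∀ α < q.len, p.val α = q.val α
  le_refl p := ⟨le_rfl, fun _ _ => rfl⟩
  le_trans p q r h1 h2 :=
    ⟨h2.1.trans h1.1, fun α hα => (h1.2 α (hα.trans_le h2.1)).trans (h2.2 α hα)⟩
  le_antisymm p q h1 h2 := by
    have hlen := le_antisymm h2.1 h1.1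
    refine Cond.ext hlen (funext fun α => ?_)
    rcases lt_or_ge α q.len with h | h
    · exact h1.2 α h
    · rw [p.val_of_le α (hlen.trans_le h), q.val_of_le α h]

theorem le_of_le_of_le {p q r : Cond w} (hp : r ≤ p) (hq : r ≤ q) (h : q.len ≤ p.len) : p ≤ q :=
  ⟨h, fun α hα => (hp.2 α (hα.trans_le h)).symm.trans (hq.2 α hα)⟩

open Classical in
/-- The condition of length `l` given by the values of `v`. -/
noncomputable def mk' (l : Ordinal.{0}) (v : Ordinal.{0} → Set Ordinal.{0} × Ordinal.{0})
    (hl : l < ω_ 2) (hv : ∀ α < l, IsValue α (v α)) (hg : ∀ β ∈ S21, β ≤ l → GoodAt w v β) :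
    Cond w where
  len := l
  val α := if α < l then v α else (∅, 0)
  len_lt := hl
  val_of_le α hα := if_neg hα.not_gt
  isValue α hα := by rw [if_pos hα]; exact hv α hα
  good β hβ hβl := (hg β hβ hβl).congr fun α hα => (if_pos (hα.trans_le hβl)).symm

theorem mk'_val {l : Ordinal.{0}} {v : Ordinal.{0} → Set Ordinal.{0} × Ordinal.{0}} {hl : l < ω_ 2}
    {hv : ∀ α < l, IsValue α (v α)} {hg : ∀ β ∈ S21, β ≤ l → GoodAt w v β} {α : Ordinal.{0}}
    (hα : α < l) : (mk' l v hl hv hg).val α = v α := if_pos hα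

theorem exists_restrict (p : Cond w) {l : Ordinal.{0}} (hl : l ≤ p.len) :
    ∃ q : Cond w, q.len = l ∧ p ≤ q :=
  ⟨mk' l p.val (hl.trans_lt p.len_lt) (fun α hα => p.isValue α (hα.trans_le hl))
    fun β hβ hβl => p.good β hβ (hβl.trans hl), rfl, hl, fun _ hα => (mk'_val hα).symm⟩

theorem exists_extend (p : Cond w) {x : Set Ordinal.{0} × Ordinal.{0}} (hx : IsValue p.len x) :
    ∃ q ≤ p, q.len = Order.succ p.len ∧ q.val p.len = x := by
  classical
  have hne : ∀ α < p.len, Function.update p.val p.len x α = p.val α := fun α hα =>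
    Function.update_of_ne hα.ne _ _
  refine ⟨mk' (Order.succ p.len) (Function.update p.val p.len x)
    (isSuccLimit_omega_two.succ_lt p.len_lt) (fun α hα => ?_) (fun β hβ hβl => ?_),
    ⟨Order.le_succ _, fun α hα => ?_⟩, rfl, ?_⟩
  · rcases (Order.lt_succ_iff.1 hα).eq_or_lt with rfl | h
    · rwa [Function.update_self]
    · rw [hne α h]
      exact p.isValue α h
  · have hle : β ≤ p.len := by
      refine Order.lt_succ_iff.1 (hβl.lt_of_ne ?_)
      rintro rfl
      exact Order.not_isSuccLimit_succ _ (isSuccLimit_of_mem_S21 hβ)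
    exact (p.good β hβ hle).congr fun α hα => (hne α (hα.trans_le hle)).symm
  · exact (mk'_val (hα.trans_le (Order.le_succ _))).trans (hne α hα)
  · exact (mk'_val (Order.lt_succ _)).trans (Function.update_self _ _ _)

/-- If `p` and `q` are compatible but `p` does not extend `q`, then `p` is shorter, and it can be
prolonged by a value that differs from that of `q`. The ordinal coordinate is carried along even
when `w` fails, so that a different value is always available. -/
theorem separative : Separative (Cond w) := by
  intro p q hpq
  by_cases hs : ∃ s, s ≤ p ∧ s ≤ q
  · obtain ⟨s, hsp, hsq⟩ := hs
    have hlen : p.len < q.len := by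
      by_contra h
      exact hpq (le_of_le_of_le hsp hsq (not_lt.1 h))
    have hv := q.isValue p.len hlen
    obtain ⟨r, hr, hrl, hrv⟩ := p.exists_extend
      (x := ((q.val p.len).1, Order.succ (q.val p.len).2))
      ⟨hv.1, hv.2.1, hv.2.2.1, isSuccLimit_omega_one.succ_lt hv.2.2.2⟩
    refine ⟨r, hr, ?_⟩
    rintro ⟨t, htr, htq⟩
    have h1 := htr.2 p.len (hrl ▸ Order.lt_succ _)
    rw [hrv, htq.2 p.len hlen] at h1
    exact (Order.lt_succ (q.val p.len).2).ne (congrArg Prod.snd h1)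
  · exact ⟨p, le_rfl, hs⟩

/-- The union of a descending sequence of conditions is a condition: all requirements below the
supremum `β` of the lengths are inherited, and only goodness of `β` itself, when `β ∈ S21`, is an
obstacle. -/
theorem exists_limit {c : Ordinal.{0} → Cond w} {o β : Ordinal.{0}} (hβ : β < ω_ 2)
    (hc : ∀ δ < o, ∀ γ < δ, c δ ≤ c γ) (hle : ∀ γ < o, (c γ).len ≤ β)
    (hcof : ∀ ξ < β, ∃ γ < o, ξ < (c γ).len)
    (hgood : β ∈ S21 → ∀ v, (∀ γ < o, ∀ ξ < (c γ).len, v ξ = (c γ).val ξ) → GoodAt w v β) :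
    ∃ r, ∀ γ < o, r ≤ c γ := by
  choose i hi hi' using hcof
  classical
  let v : Ordinal.{0} → Set Ordinal.{0} × Ordinal.{0} := fun ξ =>
    if h : ξ < β then (c (i ξ h)).val ξ else (∅, 0)
  have hv : ∀ γ < o, ∀ ξ < (c γ).len, v ξ = (c γ).val ξ := by
    intro γ hγ ξ hξ
    have h := hξ.trans_le (hle γ hγ)
    rw [show v ξ = (c (i ξ h)).val ξ from dif_pos h]
    rcases lt_trichotomy γ (i ξ h) with h1 | h1 | h1
    · exact (hc _ (hi ξ h) γ h1).2 ξ hξ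
    · rw [← h1]
    · exact ((hc γ hγ _ h1).2 ξ (hi' ξ h)).symm
  refine ⟨mk' β v hβ (fun α hα => ?_) (fun β' hβ' hle' => ?_), fun γ hγ => ⟨hle γ hγ, fun ξ hξ =>
    (mk'_val (hξ.trans_le (hle γ hγ))).trans (hv γ hγ ξ hξ)⟩⟩
  · rw [hv _ (hi α hα) α (hi' α hα)]
    exact (c (i α hα)).isValue α (hi' α hα)
  · rcases hle'.eq_or_lt with rfl | h
    · exact hgood hβ' v hv
    · exact ((c (i β' h)).good β' hβ' (hi' β' h).le).congr fun ξ hξ =>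
        (hv _ (hi β' h) ξ (hξ.trans (hi' β' h))).symm

theorem exists_len_eq_zero : ∃ p : Cond w, p.len = 0 :=
  ⟨mk' 0 (fun _ => (∅, 0)) isSuccLimit_omega_two.bot_lt (fun _ hα => absurd hα not_lt_zero)
    fun _ hβ h => absurd (le_antisymm h bot_le)
      (bot_lt_iff_ne_bot.1 (isSuccLimit_of_mem_S21 hβ).bot_lt), rfl⟩

theorem val_snd_lt (p : Cond w) (α : Ordinal.{0}) : (p.val α).2 < ω_ 1 := by
  rcases lt_or_ge α p.len with h | h
  · exact (p.isValue α h).2.2.2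
  · rw [p.val_of_le α h]
    exact isSuccLimit_omega_one.bot_lt

theorem val_fst_subset (p : Cond w) (α : Ordinal.{0}) : (p.val α).1 ⊆ Set.Iio (ω_ 2) := by
  rcases lt_or_ge α p.len with h | h
  · exact (p.isValue α h).2.1.trans (Set.Iio_subset_Iio (h.trans p.len_lt).le)
  · rw [p.val_of_le α h]
    exact Set.empty_subset _

/-- Values vanish beyond the length, so a condition is coded by its length and a function on
`Set.Iio (ω_ 2)`. -/
instance : Small.{u} (Cond w) := by
  have h1 := small_lift.{1, u, 0} (Set.Iio (ω_ 1 : Ordinal.{0}))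
  have h2 := small_lift.{1, u, 0} (Set.Iio (ω_ 2 : Ordinal.{0}))
  let F : Cond w → Set.Iio (ω_ 2 : Ordinal.{0}) ×
      (Set.Iio (ω_ 2 : Ordinal.{0}) → Set (Set.Iio (ω_ 2 : Ordinal.{0})) ×
        Set.Iio (ω_ 1 : Ordinal.{0})) := fun p =>
    (⟨p.len, p.len_lt⟩, fun α => (Subtype.val ⁻¹' (p.val α).1, ⟨(p.val α).2, p.val_snd_lt α⟩))
  refine small_of_injective (f := F) fun p q h => ?_
  have hlen : p.len = q.len := congrArg (fun x => x.1.1) h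
  refine Cond.ext hlen (funext fun α => ?_)
  rcases lt_or_ge α p.len with hα | hα
  · have h3 := congrFun (congrArg Prod.snd h) ⟨α, hα.trans p.len_lt⟩
    refine Prod.ext ?_ (congrArg (fun x => x.2.1) h3)
    have h4 := congrArg (fun x => Subtype.val '' x.1) h3
    simp only [F, Subtype.image_preimage_coe, Set.inter_eq_self_of_subset_right (val_fst_subset _ _)]
      at h4
    exact h4
  · rw [p.val_of_le α hα, q.val_of_le α (hlen ▸ hα)]

end Cond

/-! ### From the Martin-type axioms to the combinatorial principles -/

/-- The `ξ`-th countable limit ordinal. -/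
noncomputable def limitOrd (ξ : Ordinal.{0}) : Ordinal.{0} := ω * (1 + ξ)

theorem isSuccLimit_limitOrd (ξ : Ordinal.{0}) : Order.IsSuccLimit (limitOrd ξ) :=
  isSuccLimit_mul_left isSuccLimit_omega0 (zero_lt_one.trans_le le_self_add)

theorem limitOrd_strictMono : StrictMono limitOrd := fun _ _ h =>
  (mul_lt_mul_iff_right₀ omega0_pos).2 ((add_lt_add_iff_left 1).2 h)

theorem limitOrd_lt {ξ : Ordinal.{0}} (h : ξ < ω_ 1) : limitOrd ξ < ω_ 1 :=
  isPrincipal_mul_omega 1 omega0_lt_omega_one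
    (isPrincipal_add_omega 1 (one_lt_omega0.trans omega0_lt_omega_one) h)

theorem limitOrd_div_sub (ξ : Ordinal.{0}) : limitOrd ξ / ω - 1 = ξ := by
  rw [limitOrd, Ordinal.mul_div_cancel _ omega0_ne_zero, Ordinal.add_sub_cancel]

theorem lt_limitOrd_succ (ξ : Ordinal.{0}) : ξ < limitOrd (Order.succ ξ) :=
  (Order.lt_succ ξ).trans_le (le_add_self.trans (le_mul_of_one_le_left' one_lt_omega0.le))

theorem exists_lt_limitOrd {η γ : Ordinal.{0}} (hη : Order.IsSuccLimit η) (h : γ < limitOrd η) :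
    ∃ ξ < η, γ < limitOrd ξ := by
  rw [limitOrd, one_add_of_omega0_le (omega0_le_of_isSuccLimit hη),
    lt_mul_iff_of_isSuccLimit hη] at h
  obtain ⟨ξ, hξ, h⟩ := h
  refine ⟨ξ, hξ, h.trans_le ?_⟩
  rw [limitOrd]
  gcongr
  exact le_add_self

namespace Cond

variable {w : Prop}

/-- `b` is a suitable answer to the move `A`: if the supremum `δ` of the lengths of the conditions
in `A` is not attained, the value of `b` at `δ` is the set of these lengths, paired with `ν`. -/
def IsAnswer (A : Set (Cond w)) (ν : Ordinal.{0}) (b : Cond w) : Prop :=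
  b ∈ lowerBounds A ∧ 0 < b.len ∧ (∀ p ∈ A, p.len < b.len) ∧
    ∀ δ, δ ≠ 0 → (∀ p ∈ A, p.len < δ) → UnboundedIn (len '' A) δ →
      δ < b.len ∧ b.val δ = (len '' A, ν)

theorem exists_isAnswer {A : Set (Cond w)} (hA : A.Countable) {ν : Ordinal.{0}} (hν : ν < ω_ 1)
    {r : Cond w} (hr : r ∈ lowerBounds A) : ∃ b, IsAnswer A ν b := by
  let δ := sInf {δ : Ordinal.{0} | ∀ p ∈ A, p.len ≤ δ}
  have hle : ∀ p ∈ A, p.len ≤ δ := csInf_mem (s := {δ : Ordinal.{0} | ∀ p ∈ A, p.len ≤ δ})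
    ⟨r.len, fun p hp => (hr hp).1⟩
  have hmin : ∀ δ', (∀ p ∈ A, p.len ≤ δ') → δ ≤ δ' := fun δ' h => csInf_le' h
  -- Cutting a lower bound down to the supremum `δ` of the lengths keeps it a lower bound and leaves
  -- the value at `δ` free.
  obtain ⟨c, hcl, hrc⟩ := r.exists_restrict (hmin r.len fun p hp => (hr hp).1)
  have hc : c ∈ lowerBounds A := fun p hp => le_of_le_of_le hrc (hr hp) (hcl ▸ hle p hp)
  have huniq : ∀ δ', (∀ p ∈ A, p.len < δ') → UnboundedIn (len '' A) δ' → δ' = δ := by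
    intro δ' h1 h2
    refine (hmin δ' fun p hp => (h1 p hp).le).antisymm' (not_lt.1 fun h => ?_)
    obtain ⟨_, ⟨p, hp, rfl⟩, h3, -⟩ := h2 δ h
    exact (hle p hp).not_gt h3
  have hx : ∃ x, IsValue δ x ∧ (δ ≠ 0 → (∀ p ∈ A, p.len < δ) → x = (len '' A, ν)) := by
    by_cases h : δ ≠ 0 ∧ ∀ p ∈ A, p.len < δ
    · refine ⟨(len '' A, ν), ⟨hA.image len, ?_, fun _ ξ hξ => ?_, hν⟩, fun _ _ => rfl⟩
      · rintro _ ⟨p, hp, rfl⟩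
        exact h.2 p hp
      · by_contra h2
        refine (hmin ξ fun p hp => not_lt.1 fun h3 => h2 ?_).not_gt hξ
        exact ⟨_, ⟨p, hp, rfl⟩, h3, h.2 p hp⟩
    · obtain ⟨x, hx⟩ := exists_isValue δ
      exact ⟨x, hx, fun h1 h2 => absurd ⟨h1, h2⟩ h⟩
  obtain ⟨x, hx, hx'⟩ := hx
  rw [← hcl] at hx
  obtain ⟨b, hb, hbl, hbx⟩ := c.exists_extend hx
  rw [hcl] at hbl hbx
  refine ⟨b, fun p hp => hb.trans (hc hp), ?_, fun p hp => ?_, fun δ' h0 h1 h2 => ?_⟩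
  · rw [hbl]
    exact bot_le.trans_lt (Order.lt_succ δ)
  · rw [hbl]
    exact (hle p hp).trans_lt (Order.lt_succ δ)
  · obtain rfl := huniq δ' h1 h2
    exact ⟨hbl ▸ Order.lt_succ δ, hbx.trans (hx' h0 h1)⟩

open Classical in
/-- A winning tactic (up to the parameter `ν`) for Player II. -/
noncomputable def answer (A : Set (Cond w)) (ν : Ordinal.{0}) : Cond w :=
  -- The default is a condition of length zero; no answer is needed when the move has no lower
  -- bound.
  if h : ∃ b, IsAnswer A ν b then h.choose else exists_len_eq_zero.choose

theorem isAnswer_answer {A : Set (Cond w)} (hA : A.Countable) {ν : Ordinal.{0}} (hν : ν < ω_ 1)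
    (hne : (lowerBounds A).Nonempty) : IsAnswer A ν (answer A ν) := by
  obtain ⟨r, hr⟩ := hne
  have h := exists_isAnswer hA hν hr
  rw [answer, dif_pos h]
  exact h.choose_spec

/-! ### Plays on the poset of initial segments -/

section Play

variable {A : Ordinal.{0} → Set (Cond w)} {b : Ordinal.{0} → Cond w} {ψ : Ordinal.{0} → Ordinal.{0}}

theorem countable_of_legalI {α : Ordinal.{0}} (hα : α < ω_ 1) (hI : ∀ γ ≤ α, LegalI A b γ) :
    (A α).Countable := by
  induction α using WellFoundedLT.induction with
  | ind α ih =>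
    by_cases hl : Order.IsSuccLimit α
    · rw [(hI α le_rfl).1 hl]
      exact (countable_Iio_of_lt hα).biUnion fun γ hγ =>
        ih γ hγ (lt_trans hγ hα) fun δ hδ => hI δ (hδ.trans (le_of_lt hγ))
    · exact ((hI α le_rfl).2 hl).1

/-- After the answer `b γ`, Player I has to play conditions of lengths cofinal in that of `b γ`. -/
theorem exists_lt_len_of_legalI {γ : Ordinal.{0}} (h : LegalI A b (Order.succ γ)) {ξ : Ordinal.{0}}
    (hξ : ξ < (b γ).len) : ∃ p ∈ A (Order.succ γ), ξ < p.len := by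
  by_contra hne
  push Not at hne
  obtain ⟨-, -, ⟨r, hr⟩, h4⟩ := ((legalI_iff separative).1 h).2 (Order.not_isSuccLimit_succ γ)
  have h5 := (h4 γ rfl).1
  -- Truncated to length `ξ`, the lower bound `r` would still bound the move of Player I, yet be too
  -- short to extend `b γ`.
  obtain ⟨q, hq, hrq⟩ := r.exists_restrict (hξ.le.trans (h5 r hr).1)
  have hqA : q ∈ lowerBounds (A (Order.succ γ)) := fun p hp =>
    le_of_le_of_le hrq (hr hp) (hq ▸ hne p hp)
  exact ((h5 q hqA).1.trans hq.le).not_gt hξ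

/-- Player I has meanwhile played lengths cofinal in that of `b γ`. If `b δ` were no longer than `b
γ`, this supremum would not be attained in `A δ`, and the answer would have to define a value there.
-/
theorem len_lt_len {γ δ : Ordinal.{0}} (hγδ : γ < δ) (hγ : LegalI A b (Order.succ γ))
    (hδ : LegalI A b δ) (hδ' : LegalII A b δ) (h0 : 0 < (b γ).len)
    (hans : IsAnswer (A δ) (ψ δ) (b δ)) : (b γ).len < (b δ).len := by
  by_contra h
  have heq : (b γ).len = (b δ).len :=
    le_antisymm (LegalII.le separative hγ hδ hδ' hγδ).1 (not_lt.1 h)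
  have h1 : UnboundedIn (len '' A δ) (b γ).len := by
    intro ξ hξ
    obtain ⟨p, hp, h⟩ := exists_lt_len_of_legalI hγ hξ
    have hp' := hδ.mono (Order.succ_le_of_lt hγδ) hp
    exact ⟨_, ⟨p, hp', rfl⟩, h, heq ▸ hans.2.2.1 p hp'⟩
  exact (hans.2.2.2 _ h0.ne' (fun p hp => heq ▸ hans.2.2.1 p hp) h1).1.ne heq

/-- The supremum of the lengths of the answers before round `α`. -/
noncomputable def supLen (b : Ordinal.{0} → Cond w) (α : Ordinal.{0}) : Ordinal.{0} :=
  ⨆ γ : Set.Iio α, (b γ).len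

theorem len_le_supLen {γ α : Ordinal.{0}} (h : γ < α) : (b γ).len ≤ supLen b α :=
  Ordinal.le_iSup (fun γ : Set.Iio α => (b γ).len) ⟨γ, h⟩

theorem exists_lt_len {ξ α : Ordinal.{0}} (h : ξ < supLen b α) : ∃ γ < α, ξ < (b γ).len := by
  obtain ⟨γ, hγ⟩ := Ordinal.lt_iSup_iff.1 h
  exact ⟨γ, γ.2, hγ⟩

theorem supLen_lt_omega_two {α : Ordinal.{0}} (h : α ≤ ω_ 1) : supLen b α < ω_ 2 :=
  iSup_lt_omega_two (fun γ => (b γ).len) (fun γ _ => (b γ).len_lt) h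

/-- The facts about the rounds below `o` of a play in which Player II answers by `answer`. -/
structure Played (A : Ordinal.{0} → Set (Cond w)) (b : Ordinal.{0} → Cond w)
    (ψ : Ordinal.{0} → Ordinal.{0}) (o : Ordinal.{0}) : Prop where
  legalI : ∀ γ < o, LegalI A b γ
  legalII : ∀ γ < o, LegalII A b γ
  isAnswer : ∀ γ < o, IsAnswer (A γ) (ψ γ) (b γ)

theorem Played.le {o γ δ : Ordinal.{0}} (h : Played A b ψ o) (hδ : δ < o) (hγ : γ < δ) :
    b δ ≤ b γ :=
  LegalII.le separative (h.legalI _ ((Order.succ_le_of_lt hγ).trans_lt hδ)) (h.legalI δ hδ)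
    (h.legalII δ hδ) hγ

theorem Played.len_lt {o γ δ : Ordinal.{0}} (h : Played A b ψ o) (hδ : δ < o) (hγ : γ < δ) :
    (b γ).len < (b δ).len :=
  len_lt_len hγ (h.legalI _ ((Order.succ_le_of_lt hγ).trans_lt hδ)) (h.legalI δ hδ)
    (h.legalII δ hδ) (h.isAnswer γ (hγ.trans hδ)).2.1 (h.isAnswer δ hδ)

theorem Played.len_lt_supLen {o α γ : Ordinal.{0}} (h : Played A b ψ o) (hα : Order.IsSuccLimit α)
    (hαo : α ≤ o) (hγ : γ < α) : (b γ).len < supLen b α :=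
  (h.len_lt ((hα.succ_lt hγ).trans_le hαo) (Order.lt_succ γ)).trans_le
    (len_le_supLen (hα.succ_lt hγ))

theorem Played.supLen_mem_S20 {o α : Ordinal.{0}} (h : Played A b ψ o) (hα : Order.IsSuccLimit α)
    (hαo : α ≤ o) (hα1 : α < ω_ 1) : supLen b α ∈ S20 := by
  refine UnboundedIn.mem_S20 (X := (fun γ => (b γ).len) '' Set.Iio α) ?_
    ((countable_Iio_of_lt hα1).image _) (supLen_lt_omega_two hα1.le)
    (bot_lt_iff_ne_bot.1 (bot_le.trans_lt (h.len_lt_supLen hα hαo hα.bot_lt)))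
  intro ξ hξ
  obtain ⟨γ, hγ, hlt⟩ := exists_lt_len hξ
  exact ⟨_, ⟨γ, hγ, rfl⟩, hlt, h.len_lt_supLen hα hαo hγ⟩

theorem Played.exists_lowerBound {o : Ordinal.{0}} (h : Played A b ψ o) (ho : o ≤ ω_ 1)
    (hgood : supLen b o ∈ S21 → ∀ v, (∀ γ < o, ∀ ξ < (b γ).len, v ξ = (b γ).val ξ) →
      GoodAt w v (supLen b o)) : ∃ r, ∀ γ < o, r ≤ b γ :=
  exists_limit (supLen_lt_omega_two ho) (fun _ hδ _ hγ => h.le hδ hγ)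
    (fun _ hγ => len_le_supLen hγ) (fun _ hξ => exists_lt_len hξ) hgood

/-- The value of the answer in a limit round `α`. -/
theorem Played.val_supLen {o α : Ordinal.{0}} (h : Played A b ψ o) (hα : Order.IsSuccLimit α)
    (hαo : α < o) : supLen b α < (b α).len ∧ (b α).val (supLen b α) = (len '' A α, ψ α) := by
  have hlt : ∀ p ∈ A α, p.len < supLen b α := by
    intro p hp
    rw [(h.legalI α hαo).1 hα] at hp
    obtain ⟨γ, hγ, hp⟩ := Set.mem_iUnion₂.1 hp
    exact ((h.isAnswer γ (hγ.trans hαo)).2.2.1 p hp).trans_le (len_le_supLen hγ)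
  refine (h.isAnswer α hαo).2.2.2 _
    (bot_lt_iff_ne_bot.1 (bot_le.trans_lt (h.len_lt_supLen hα hαo.le hα.bot_lt))) hlt ?_
  intro ξ hξ
  obtain ⟨γ, hγ, hξγ⟩ := exists_lt_len hξ
  have hs := hα.succ_lt hγ
  obtain ⟨p, hp, hξp⟩ := exists_lt_len_of_legalI (h.legalI _ (hs.trans hαo)) hξγ
  have hp' := (h.legalI α hαo).mono hs.le hp
  exact ⟨_, ⟨p, hp', rfl⟩, hξp, hlt p hp'⟩

theorem Played.supLen_lt_supLen {o α δ : Ordinal.{0}} (h : Played A b ψ o)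
    (hα : Order.IsSuccLimit α) (hδ : δ ≤ o) (hαδ : α < δ) : supLen b α < supLen b δ :=
  (h.val_supLen hα (hαδ.trans_le hδ)).1.trans_le (len_le_supLen hαδ)

/-- A condition that is new in `A δ` extends the answer `b α`, which is longer than every member of
`A α`. -/
theorem Played.endExtends {o α δ : Ordinal.{0}} (h : Played A b ψ o) (hδ : δ < o) (hαδ : α < δ) :
    EndExtends (len '' A δ) (len '' A α) := by
  refine ⟨Set.image_mono ((h.legalI δ hδ).mono hαδ.le), ?_⟩
  rintro _ ⟨⟨p, hp, rfl⟩, hp'⟩ _ ⟨q, hq, rfl⟩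
  have h1 := LegalI.le_of_mem separative (fun γ hγ => h.legalI γ (hγ.trans_lt hδ))
    (fun γ hγ => h.legalII γ (hγ.trans hδ)) hαδ hp fun h2 => hp' ⟨p, h2, rfl⟩
  exact ((h.isAnswer α (hαδ.trans hδ)).2.2.1 q hq).trans_le h1.1

/-- The club consists of the suprema of the lengths at limit rounds. There the answers recorded the
lengths played so far, and these sets end-extend each other; the recorded `ψ` is the index in the
club. -/
theorem Played.goodAt (h : Played A b ψ (ω_ 1)) (hψ : w → ∀ ξ < ω_ 1, ψ (limitOrd ξ) = ξ)
    {v : Ordinal.{0} → Set Ordinal.{0} × Ordinal.{0}}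
    (hv : ∀ γ < ω_ 1, ∀ ξ < (b γ).len, v ξ = (b γ).val ξ) : GoodAt w v (supLen b (ω_ 1)) := by
  let g : Ordinal.{0} → Ordinal.{0} := fun ξ => supLen b (limitOrd ξ)
  have hg : StrictMonoOn g (Set.Iio (ω_ 1)) := fun ξ hξ η hη hlt =>
    h.supLen_lt_supLen (isSuccLimit_limitOrd ξ) (limitOrd_lt hη).le (limitOrd_strictMono hlt)
  have hgval : ∀ ξ < ω_ 1, v (g ξ) = (len '' A (limitOrd ξ), ψ (limitOrd ξ)) := by
    intro ξ hξ
    have h1 := h.val_supLen (isSuccLimit_limitOrd ξ) (limitOrd_lt hξ)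
    rw [hv _ (limitOrd_lt hξ) _ h1.1, h1.2]
  have hgS : ∀ ξ < ω_ 1, g ξ < supLen b (ω_ 1) ∧ g ξ ∈ S20 := fun ξ hξ =>
    ⟨h.supLen_lt_supLen (isSuccLimit_limitOrd ξ) le_rfl (limitOrd_lt hξ),
      h.supLen_mem_S20 (isSuccLimit_limitOrd ξ) (limitOrd_lt hξ).le (limitOrd_lt hξ)⟩
  have hunb : ∀ ξ < supLen b (ω_ 1), ∃ i < ω_ 1, ξ < g i := by
    intro ξ hξ
    obtain ⟨γ, hγ, h1⟩ := exists_lt_len hξ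
    exact ⟨Order.succ γ, isSuccLimit_omega_one.succ_lt hγ,
      h1.trans_le (len_le_supLen (lt_limitOrd_succ γ))⟩
  refine ⟨g '' Set.Iio (ω_ 1), ⟨?_, ?_, ?_⟩, ?_, ?_, ?_⟩
  · rintro _ ⟨ξ, hξ, rfl⟩
    exact hgS ξ hξ
  · intro ξ hξ
    obtain ⟨i, hi, h1⟩ := hunb ξ hξ
    exact ⟨g i, ⟨i, hi, rfl⟩, h1, (hgS i hi).1⟩
  · rintro δ ⟨hδ, hδS⟩ hδu
    have hne : {η | η < ω_ 1 ∧ δ ≤ g η}.Nonempty := by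
      obtain ⟨i, hi, h1⟩ := hunb δ hδ
      exact ⟨i, hi, h1.le⟩
    -- The least index whose supremum reaches `δ` is a limit because the club is unbounded in `δ`;
    -- continuity of `limitOrd` at limits then gives `g η = δ`.
    let η := sInf {η | η < ω_ 1 ∧ δ ≤ g η}
    have hη : η < ω_ 1 ∧ δ ≤ g η := csInf_mem hne
    have hmin : ∀ ξ < η, g ξ < δ := fun ξ hξ => by
      by_contra h1
      exact (csInf_le' (s := {η | η < ω_ 1 ∧ δ ≤ g η}) ⟨hξ.trans hη.1, not_lt.1 h1⟩).not_gt hξ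
    have hlt : ∀ ξ < ω_ 1, g ξ < δ → ξ < η := fun ξ hξ h1 => by
      by_contra h2
      exact (hη.2.trans (hg.monotoneOn hη.1 hξ (not_lt.1 h2))).not_gt h1
    have hηl : Order.IsSuccLimit η := by
      refine ⟨fun h1 => ?_, fun ζ hζ => ?_⟩
      · obtain ⟨_, ⟨ξ, hξ, rfl⟩, -, h2⟩ := hδu 0 (isSuccLimit_of_mem_S20 hδS).bot_lt
        exact h1.not_lt (hlt ξ hξ h2)
      · obtain ⟨_, ⟨ξ, hξ, rfl⟩, h1, h2⟩ := hδu (g ζ) (hmin ζ hζ.lt)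
        exact hζ.2 ((hg.lt_iff_lt (hζ.lt.trans hη.1) hξ).1 h1) (hlt ξ hξ h2)
    refine ⟨η, hη.1, le_antisymm ?_ hη.2⟩
    refine Ordinal.iSup_le fun γ => ?_
    obtain ⟨ξ, hξ, h1⟩ := exists_lt_limitOrd hηl γ.2
    exact (len_le_supLen h1).trans (hmin ξ hξ).le
  · rw [otp_image_Iio hg, lift_omega]
    simp
  · rintro hw _ ⟨ξ, hξ, rfl⟩
    rw [otp_image_inter_Iio hg hξ, hgval ξ hξ]
    exact congrArg _ (hψ hw ξ hξ)
  · rintro _ ⟨ξ, hξ, rfl⟩ _ ⟨η, hη, rfl⟩ hlt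
    simp only [hgval ξ hξ, hgval η hη]
    exact h.endExtends (limitOrd_lt hη) (limitOrd_strictMono ((hg.lt_iff_lt hξ hη).1 hlt))

end Play

theorem isWinning_answer {ψ : Ordinal.{0} → Ordinal.{0}} (hψ1 : ∀ α < ω_ 1, ψ α < ω_ 1)
    (hψ : w → ∀ ξ < ω_ 1, ψ (limitOrd ξ) = ξ) :
    IsWinning fun (A : Set (Cond w)) α => answer A (ψ α) := by
  intro A b hb
  have hans : ∀ α < ω_ 1, (∀ γ ≤ α, LegalI A b γ) → (lowerBounds (A α)).Nonempty →
      IsAnswer (A α) (ψ α) (b α) := fun α hα hI hne => by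
    rw [hb α hα]
    exact isAnswer_answer (countable_of_legalI hα hI) (hψ1 α hα) hne
  have hplayed : ∀ o ≤ ω_ 1, (∀ γ < o, LegalI A b γ) → (∀ γ < o, LegalII A b γ) →
      Played A b ψ o := fun o ho hI hII => ⟨hI, hII, fun γ hγ => hans γ (hγ.trans_le ho)
    (fun δ hδ => hI δ (hδ.trans_lt hγ)) ⟨_, (legalII_iff separative).1 (hII γ hγ)⟩⟩
  constructor
  · intro α hα hI hII
    refine (legalII_iff separative).2 (hans α hα hI ?_).1
    by_cases hl : Order.IsSuccLimit α
    · have h := hplayed α hα.le (fun γ hγ => hI γ hγ.le) hII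
      -- At a countable limit round the supremum has cofinality `ω`, so no goodness is demanded of
      -- it. It matters only in round `ω₁`.
      obtain ⟨r, hr⟩ := h.exists_lowerBound hα.le fun h' =>
        absurd h' (not_mem_S21_of_mem_S20 (h.supLen_mem_S20 hl le_rfl hα))
      refine ⟨r, fun p hp => ?_⟩
      rw [(hI α le_rfl).1 hl] at hp
      obtain ⟨γ, hγ, hp⟩ := Set.mem_iUnion₂.1 hp
      exact (hr γ hγ).trans ((legalII_iff separative).1 (hII γ hγ) hp)
    · exact (((legalI_iff separative).1 (hI α le_rfl)).2 hl).2.2.1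
  · intro hleg
    have h := hplayed _ le_rfl (fun γ hγ => (hleg γ hγ).1) fun γ hγ => (hleg γ hγ).2
    obtain ⟨r, hr⟩ := h.exists_lowerBound le_rfl fun _ v hv => h.goodAt hψ hv
    exact ⟨r, fun α hα => ⟨fun p hp => (hr α hα).trans ((legalII_iff separative).1 (hleg α hα).2 hp),
      hr α hα⟩⟩

/-- Lengths in `S21` cannot be reached by extending naively, since they have to be good points.
Instead, by induction, conditions of length at least `i` are dense for each `i < γ`, and
distributivity meets these `ℵ₁` many dense sets simultaneously; one further step reaches `γ`. -/
theorem exists_le_len {σ : Set (Cond w) → Ordinal.{0} → Cond w} (hσ : IsWinning σ)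
    {γ : Ordinal.{0}} (hγ : γ < ω_ 2) (p : Cond w) : ∃ r ≤ p, γ ≤ r.len := by
  induction γ using WellFoundedLT.induction generalizing p with
  | ind γ ih =>
    have hcard : #γ.ToType ≤ ℵ_ 1 := by
      rw [Cardinal.mk_toType]
      exact card_le_aleph_one_of_lt hγ
    obtain ⟨q, hq, h⟩ := hσ.exists_below separative p hcard
      (fun i => {r | (i.toOrd : Ordinal.{0}) ≤ r.len}) fun i q _ => by
        obtain ⟨r, hr, h⟩ := ih i.toOrd i.toOrd.2 (lt_trans i.toOrd.2 hγ) q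
        exact ⟨r, h, hr⟩
    obtain ⟨x, hx⟩ := exists_isValue q.len
    obtain ⟨r, hr, hrl, -⟩ := q.exists_extend hx
    refine ⟨r, hr.trans hq, le_of_forall_lt fun ξ hξ => ?_⟩
    obtain ⟨s, hs, hqs⟩ := h (ToType.mk ⟨ξ, hξ⟩)
    rw [hrl, Order.lt_succ_iff]
    simp only [Set.mem_ofPred_eq, OrderIso.symm_apply_apply] at hs
    exact le_trans hs hqs.1

/-- The Martin-type axiom yields a system all of whose initial segments are conditions. -/
theorem exists_system {σ : Set (Cond w) → Ordinal.{0} → Cond w} (hσ : IsWinning σ)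
    (h : MA (Cond w) (ω_ 2)) : ∃ v : Ordinal.{0} → Set Ordinal.{0} × Ordinal.{0},
      (∀ α < ω_ 2, IsValue α (v α)) ∧ ∀ β ∈ S21, GoodAt w v β := by
  obtain ⟨F, -, hF⟩ := h exists_len_eq_zero.choose (fun γ => {r | Order.succ γ ≤ r.len})
    fun γ hγ q => by
      obtain ⟨r, hr, h⟩ := exists_le_len hσ (isSuccLimit_omega_two.succ_lt hγ) q
      exact ⟨r, h, hr⟩
  choose c hc hcF using hF
  classical
  let v : Ordinal.{0} → Set Ordinal.{0} × Ordinal.{0} := fun α =>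
    if h : α < ω_ 2 then (c α h).val α else (∅, 0)
  have hv : ∀ p ∈ F, ∀ α < p.len, p.val α = v α := by
    intro p hp α hα
    have h := hα.trans p.len_lt
    -- Members of a filter have a common extension, so they agree wherever both are defined.
    obtain ⟨r, -, h1, h2⟩ := F.directed _ hp _ (hcF α h)
    rw [show v α = (c α h).val α from dif_pos h, ← h1.2 α hα,
      h2.2 α ((Order.lt_succ α).trans_le (hc α h))]
  refine ⟨v, fun α hα => ?_, fun β hβ => ?_⟩
  · rw [show v α = (c α hα).val α from dif_pos hα]
    exact (c α hα).isValue α ((Order.lt_succ α).trans_le (hc α hα))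
  · have hle : β ≤ (c β hβ.1).len := (Order.le_succ β).trans (hc β hβ.1)
    exact ((c β hβ.1).good β hβ hle).congr fun α hα => hv _ (hcF β hβ.1) α (hα.trans_le hle)

end Cond

theorem isS20System_of_isValue {v : Ordinal.{0} → Set Ordinal.{0} × Ordinal.{0}}
    (h : ∀ α < ω_ 2, IsValue α (v α)) : IsS20System fun α => (v α).1 := fun α hα =>
  ⟨(h α hα.1).1, (h α hα.1).2.1, (h α hα.1).2.2.1 hα⟩

theorem MAClass.sclEMinus (h : MAClass.{u} (ω_ 2) TacticallyClosed) : SCLeMinus := by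
  have hσ : IsWinning fun (A : Set (Cond False)) _ => Cond.answer A 0 :=
    Cond.isWinning_answer (ψ := fun _ => 0) (fun _ _ => isSuccLimit_omega_one.bot_lt) False.elim
  obtain ⟨P, _, ⟨e⟩⟩ := exists_orderIso_of_small.{u} (Cond False)
  obtain ⟨v, hv, hg⟩ := Cond.exists_system hσ
    ((h P ⟨Cond.separative.of_orderIso e, _, hσ.of_orderIso Cond.separative e⟩).of_orderIso e)
  refine ⟨_, isS20System_of_isValue hv, fun β hβ => ?_⟩
  obtain ⟨C, h1, h2, -, h3⟩ := hg β hβ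
  exact ⟨C, h1, h2, h3⟩

theorem MAClass.sclE (h : MAClass.{u} (ω_ 2) OperationallyClosed) : SCLe := by
  -- In round `ω * (1 + ξ)` the operation must record `ξ`, the index of that limit round; `α / ω -
  -- 1` recovers it, and it is countable because it is at most `α`.
  have hσ : IsWinning fun (A : Set (Cond True)) α => Cond.answer A (α / ω - 1) :=
    Cond.isWinning_answer (ψ := fun α => α / ω - 1)
      (fun α hα => ((Ordinal.sub_le_self _ _).trans (Ordinal.div_le_of_le_mul
        (le_mul_of_one_le_left' one_lt_omega0.le))).trans_lt hα)
      fun _ ξ _ => limitOrd_div_sub ξ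
  obtain ⟨P, _, ⟨e⟩⟩ := exists_orderIso_of_small.{u} (Cond True)
  obtain ⟨v, hv, hg⟩ := Cond.exists_system hσ
    ((h P ⟨Cond.separative.of_orderIso e, _, hσ.of_orderIso Cond.separative e⟩).of_orderIso e)
  refine ⟨fun α => (v α).2, _, fun α hα => (hv α hα.1).2.2.2, isS20System_of_isValue hv,
    fun β hβ => ?_⟩
  obtain ⟨C, h1, h2, h3, h4⟩ := hg β hβ
  exact ⟨C, h1, h2, h3 trivial, h4⟩

end DoubleStar

theorem mainTheorem1 :
    (DoubleStar.SCLeMinus ↔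
      DoubleStar.MAClass.{u} (Ordinal.omega 2) DoubleStar.TacticallyClosed) ∧
    (DoubleStar.SCLe ↔
      DoubleStar.MAClass.{u} (Ordinal.omega 2) DoubleStar.OperationallyClosed) :=
  ⟨⟨DoubleStar.SCLeMinus.maClass, DoubleStar.MAClass.sclEMinus⟩,
    ⟨DoubleStar.SCLe.maClass, DoubleStar.MAClass.sclE⟩⟩
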